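/- Let $D\subset\mathbb R^2$ be a compact, connected and simply connected domain with non-empty interior whose boundary $\partial D$ is a smooth regular simple closed curve. Let $U\supseteq D$ be open, let $h$ be an arbitrary smooth Riemannian metric on $U$, with area form $\omega=\sqrt{EG-F^2}\,dx\wedge dy$ (where $E,F,G$ are the coefficients of $h$), and let $H:U\to\mathbb R$ be smooth. Let $X_H$ be the Hamiltonian vector field of $H$, given by $\omega(X_H,\cdot)=dH$. A point $p$ is called a conformal point of $X_H$ if $(L_{X_H}h)_p=c\,h_p$ for some $c\in\mathbb R$. With the positively oriented $h$-orthonormal frame $(e_1,e_2)$ obtained from $(\partial_x,\partial_y)$ by the Gram–Schmidt process, the conformal points are the zeros of the planar vector field $$V=\Bigl((L_{X_H}h)(e_1,e_2),\ \tfrac12\bigl[(L_{X_H}h)(e_2,e_2)-(L_{X_H}h)(e_1,e_1)\bigr]\Bigr),$$ and the multiplicity of an isolated conformal point $p$ is the index of $V$ at $p$, that is, the winding number of $V$ along all sufficiently small counterclockwise circles around $p$. (If $h=g^{-1}(dx^2+dy^2)$ with $g>0$, then $X_H=g(H_y\partial_x-H_x\partial_y)$ and $V=[(gH_y)_y-(gH_x)_x]\,\partial_x-[(gH_x)_y+(gH_y)_x]\,\partial_y$.)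 Suppose that $dH=0$ at every point of $\partial D$ and that $X_H$ has no conformal points on $\partial D$. Then $X_H$ has two conformal points in the interior of $D$, counted with multiplicity: either it has infinitely many conformal points in the interior of $D$, or it has only finitely many there, each of them is isolated, and the sum of their multiplicities equals $2$. -/

import Mathlib

open Set Filter Topology
open scoped ContDiff

noncomputable section

/- The plane `ℝ²` is modelled by `ℂ`, with `∂ₓ = 1` and `∂_y = Complex.I`; all derivatives are
real Fréchet derivatives. -/

/-- A compact connected and simply connected planar domain with non-empty interior, bounded by a
smooth regular simple closed curve. -/
structure IsSmoothJordanDomain (D : Set ℂ) : Prop where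
  isCompact : IsCompact D
  interior_nonempty : (interior D).Nonempty
  simplyConnected : IsSimplyConnected D
  boundary : ∃ γ : ℝ → ℂ, ContDiff ℝ ∞ γ ∧ Function.Periodic γ 1 ∧ InjOn γ (Ico 0 1) ∧
    (∀ t, deriv γ t ≠ 0) ∧ frontier D = range γ

/-- `h` is a smooth Riemannian metric on `U`. -/
structure IsRiemannianMetricOn (h : ℂ → ℂ →L[ℝ] ℂ →L[ℝ] ℝ) (U : Set ℂ) : Prop where
  smooth : ContDiffOn ℝ ∞ h U
  symm : ∀ p ∈ U, ∀ u v, h p u v = h p v u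
  pos : ∀ p ∈ U, ∀ v, v ≠ 0 → 0 < h p v v

/-- The density `√(E G - F²)` of the Riemannian area form with respect to `dx ∧ dy`. -/
def areaDensity (h : ℂ → ℂ →L[ℝ] ℂ →L[ℝ] ℝ) (p : ℂ) : ℝ :=
  Real.sqrt (h p 1 1 * h p Complex.I Complex.I - h p 1 Complex.I ^ 2)

/-- The Riemannian area form `√(E G - F²) dx ∧ dy`. -/
def areaForm (h : ℂ → ℂ →L[ℝ] ℂ →L[ℝ] ℝ) (p u v : ℂ) : ℝ :=
  areaDensity h p * (u.re * v.im - u.im * v.re)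

/-- The Hamiltonian vector field `(E G - F²)^(-1/2) (H_y ∂ₓ - H_x ∂_y)` of `H`. -/
def hamiltonianField (h : ℂ → ℂ →L[ℝ] ℂ →L[ℝ] ℝ) (H : ℂ → ℝ) (p : ℂ) : ℂ :=
  ⟨fderiv ℝ H p Complex.I / areaDensity h p, -(fderiv ℝ H p 1 / areaDensity h p)⟩

theorem IsRiemannianMetricOn.det_pos {h : ℂ → ℂ →L[ℝ] ℂ →L[ℝ] ℝ} {U : Set ℂ}
    (hh : IsRiemannianMetricOn h U) {p : ℂ} (hp : p ∈ U) :
    0 < h p 1 1 * h p Complex.I Complex.I - h p 1 Complex.I ^ 2 := by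
  have hE : 0 < h p 1 1 := hh.pos p hp 1 one_ne_zero
  have hv := hh.pos p hp ((h p 1 1) • Complex.I - (h p 1 Complex.I) • (1 : ℂ)) (by
    intro h0
    have := congrArg Complex.im h0
    simp at this
    exact hE.ne' this)
  have hs := hh.symm p hp Complex.I 1
  simp only [map_sub, map_smul, sub_apply, smul_apply,
    smul_eq_mul, hs] at hv
  have : 0 < h p 1 1 * (h p 1 1 * h p Complex.I Complex.I - h p 1 Complex.I ^ 2) := by
    linarith
  exact (mul_pos_iff_of_pos_left hE).1 this

/-- The field `hamiltonianField h H` satisfies `ι_X ω = dH` for the area form `ω`. -/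
theorem areaForm_hamiltonianField {h : ℂ → ℂ →L[ℝ] ℂ →L[ℝ] ℝ} {U : Set ℂ}
    (hh : IsRiemannianMetricOn h U) (H : ℂ → ℝ) {p : ℂ} (hp : p ∈ U) (v : ℂ) :
    areaForm h p (hamiltonianField h H p) v = fderiv ℝ H p v := by
  have hd : areaDensity h p ≠ 0 := (Real.sqrt_pos.2 (hh.det_pos hp)).ne'
  have hv : v = v.re • (1 : ℂ) + v.im • Complex.I := by
    apply Complex.ext <;> simp
  conv_rhs => rw [hv, map_add, map_smul, map_smul]
  simp only [areaForm, hamiltonianField, smul_eq_mul]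
  field_simp
  ring

/-- The Lie derivative `(L_X h)(u, v)` of the metric at `p`. -/
def lieDerivMetric (h : ℂ → ℂ →L[ℝ] ℂ →L[ℝ] ℝ) (X : ℂ → ℂ) (p u v : ℂ) : ℝ :=
  fderiv ℝ h p (X p) u v + h p (fderiv ℝ X p u) v + h p u (fderiv ℝ X p v)

/-- `p` is a conformal point of `X`: infinitesimally, the flow of `X` acts at `p` as a
similarity of the metric, that is, `L_X h` is a multiple of `h` at `p`. -/
def IsConformalPoint (h : ℂ → ℂ →L[ℝ] ℂ →L[ℝ] ℝ) (X : ℂ → ℂ) (p : ℂ) : Prop :=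
  ∃ c : ℝ, ∀ u v, lieDerivMetric h X p u v = c * h p u v

/-- The first vector of the positively oriented `h`-orthonormal frame obtained from
`(∂ₓ, ∂_y)` by the Gram-Schmidt process. -/
def frameFst (h : ℂ → ℂ →L[ℝ] ℂ →L[ℝ] ℝ) (p : ℂ) : ℂ :=
  (Real.sqrt (h p 1 1))⁻¹ • (1 : ℂ)

/-- The second vector of that frame. -/
def frameSnd (h : ℂ → ℂ →L[ℝ] ℂ →L[ℝ] ℝ) (p : ℂ) : ℂ :=
  (Real.sqrt (h p 1 1) * areaDensity h p)⁻¹ •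
    ((h p 1 1) • Complex.I - (h p 1 Complex.I) • (1 : ℂ))

/-- The field `V` whose zeros are the conformal points of `X`: the components in the frame
`(e₁, e₂)` of the trace-free part of `L_X h`, in the normalization
`V = ((L_X h)(e₁, e₂), ((L_X h)(e₂, e₂) - (L_X h)(e₁, e₁)) / 2)`.
For a conformal metric `g⁻¹ (dx² + dy²)` and the Hamiltonian field `X` of `H` this is
`V = [(g H_y)_y - (g H_x)_x] ∂ₓ - [(g H_x)_y + (g H_y)_x] ∂_y`. -/
def conformalDefect (h : ℂ → ℂ →L[ℝ] ℂ →L[ℝ] ℝ) (X : ℂ → ℂ) (p : ℂ) : ℂ :=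
  ⟨lieDerivMetric h X p (frameFst h p) (frameSnd h p),
    (lieDerivMetric h X p (frameSnd h p) (frameSnd h p) -
      lieDerivMetric h X p (frameFst h p) (frameFst h p)) / 2⟩

theorem lieDerivMetric_symm {h : ℂ → ℂ →L[ℝ] ℂ →L[ℝ] ℝ} {U : Set ℂ} (hU : IsOpen U)
    (hh : IsRiemannianMetricOn h U) (X : ℂ → ℂ) {p : ℂ} (hp : p ∈ U) (u v : ℂ) :
    lieDerivMetric h X p u v = lieDerivMetric h X p v u := by
  have hd : DifferentiableAt ℝ h p :=
    ((hh.smooth.contDiffAt (hU.mem_nhds hp)).differentiableAt (by simp))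
  have key : ∀ a b : ℂ, fderiv ℝ (fun q => h q a b) p (X p) = fderiv ℝ h p (X p) a b := by
    intro a b
    have h1 := (hd.hasFDerivAt.clm_apply (hasFDerivAt_const a p)).clm_apply
      (hasFDerivAt_const b p)
    rw [h1.fderiv]
    simp
  have he : (fun q => h q u v) =ᶠ[𝓝 p] fun q => h q v u :=
    Filter.mem_of_superset (hU.mem_nhds hp) fun q hq => hh.symm q hq u v
  have h2 : fderiv ℝ h p (X p) u v = fderiv ℝ h p (X p) v u := by
    rw [← key, ← key, he.fderiv_eq]
  unfold lieDerivMetric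
  rw [h2, hh.symm p hp (fderiv ℝ X p u) v, hh.symm p hp u (fderiv ℝ X p v)]
  ring

/-- The zeros of `conformalDefect h X` are the conformal points of `X`. -/
theorem conformalDefect_eq_zero_iff {h : ℂ → ℂ →L[ℝ] ℂ →L[ℝ] ℝ} {U : Set ℂ} (hU : IsOpen U)
    (hh : IsRiemannianMetricOn h U) (X : ℂ → ℂ) {p : ℂ} (hp : p ∈ U) :
    conformalDefect h X p = 0 ↔ IsConformalPoint h X p := by
  have hE : 0 < h p 1 1 := hh.pos p hp 1 one_ne_zero
  have hdet := hh.det_pos hp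
  have hs := hh.symm p hp Complex.I 1
  have hL := lieDerivMetric_symm hU hh X hp Complex.I 1
  obtain ⟨s, hs0, hsE⟩ : ∃ s, 0 < s ∧ s = Real.sqrt (h p 1 1) := ⟨_, Real.sqrt_pos.2 hE, rfl⟩
  obtain ⟨w, hw0, hw⟩ : ∃ w, 0 < w ∧ w = areaDensity h p := ⟨_, Real.sqrt_pos.2 hdet, rfl⟩
  have hs2 : s ^ 2 = h p 1 1 := by rw [hsE]; exact Real.sq_sqrt hE.le
  have hw2 : w ^ 2 = h p 1 1 * h p Complex.I Complex.I - h p 1 Complex.I ^ 2 := by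
    rw [hw]; exact Real.sq_sqrt hdet.le
  -- expansion in the coordinate frame
  have bil : ∀ a b c d : ℝ, lieDerivMetric h X p (a • (1 : ℂ) + b • Complex.I)
      (c • (1 : ℂ) + d • Complex.I) = a * c * lieDerivMetric h X p 1 1
        + (a * d + b * c) * lieDerivMetric h X p 1 Complex.I
        + b * d * lieDerivMetric h X p Complex.I Complex.I := by
    intro a b c d
    have : lieDerivMetric h X p (a • (1 : ℂ) + b • Complex.I) (c • (1 : ℂ) + d • Complex.I)
        = a * c * lieDerivMetric h X p 1 1 + a * d * lieDerivMetric h X p 1 Complex.I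
        + b * c * lieDerivMetric h X p Complex.I 1
        + b * d * lieDerivMetric h X p Complex.I Complex.I := by
      simp only [lieDerivMetric, map_add, map_smul, add_apply, smul_apply, smul_eq_mul]
      ring
    rw [this, hL]; ring
  have bilh : ∀ a b c d : ℝ, h p (a • (1 : ℂ) + b • Complex.I)
      (c • (1 : ℂ) + d • Complex.I) = a * c * h p 1 1
        + (a * d + b * c) * h p 1 Complex.I + b * d * h p Complex.I Complex.I := by
    intro a b c d
    simp only [map_add, map_smul, add_apply, smul_apply, smul_eq_mul, hs]
    ring
  have f1 : frameFst h p = s⁻¹ • (1 : ℂ) + (0 : ℝ) • Complex.I := by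
    simp [frameFst, hsE]
  have f2 : frameSnd h p = (-((s * w)⁻¹ * h p 1 Complex.I)) • (1 : ℂ)
      + ((s * w)⁻¹ * h p 1 1) • Complex.I := by
    rw [frameSnd, ← hsE, ← hw]
    module
  have hexp : ∀ v : ℂ, v = v.re • (1 : ℂ) + v.im • Complex.I := by
    intro v; apply Complex.ext <;> simp
  have hz : conformalDefect h X p = 0 ↔
      lieDerivMetric h X p (frameFst h p) (frameSnd h p) = 0 ∧
      lieDerivMetric h X p (frameSnd h p) (frameSnd h p) =
        lieDerivMetric h X p (frameFst h p) (frameFst h p) := by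
    rw [Complex.ext_iff]
    simp [conformalDefect, sub_eq_zero]
  rw [hz, f1, f2, bil, bil, bil]
  set A := lieDerivMetric h X p 1 1
  set B := lieDerivMetric h X p 1 Complex.I
  set C := lieDerivMetric h X p Complex.I Complex.I
  set E := h p 1 1
  set F := h p 1 Complex.I
  set G := h p Complex.I Complex.I
  have hE' : E ≠ 0 := hE.ne'
  have hw' : w ≠ 0 := hw0.ne'
  have hs' : s ≠ 0 := hs0.ne'
  constructor
  · rintro ⟨h1, h2⟩
    have e1 : E * B = F * A := by
      field_simp at h1
      linarith
    have e2 : E * C = G * A := by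
      field_simp at h2
      have h3 : F ^ 2 * A - 2 * F * E * B + E ^ 2 * C = w ^ 2 * A := by linarith
      rw [hw2] at h3
      have : E * (E * C) = E * (G * A) := by linear_combination h3 + 2 * F * e1
      exact mul_left_cancel₀ hE' this
    refine ⟨A / E, fun u v => ?_⟩
    rw [hexp u, hexp v, bil, bilh]
    have hB : B = A / E * F := by field_simp; linarith
    have hC : C = A / E * G := by field_simp; linarith
    have hA : A = A / E * E := by field_simp
    change _ * A + _ * B + _ * C = A / E * (_ * E + _ * F + _ * G)
    rw [hB, hC]
    nth_rewrite 1 [hA]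
    ring
  · rintro ⟨c, hc⟩
    have hA : A = c * E := hc 1 1
    have hB : B = c * F := hc 1 Complex.I
    have hC : C = c * G := hc Complex.I Complex.I
    rw [hA, hB, hC]
    constructor
    · field_simp
      ring
    · field_simp
      linear_combination c * E * (- hw2)

/-- The loop `f`, parametrized by `[0, 2π]`, avoids `0` and has winding number `n` around `0`:
a continuous choice of its argument increases by `2πn`. -/
def HasWindingNumber (f : ℝ → ℂ) (n : ℤ) : Prop :=
  (∀ t, f t ≠ 0) ∧ ∃ φ : ℝ → ℝ, Continuous φ ∧
    (∀ t, f t = ‖f t‖ * Complex.exp (φ t * Complex.I)) ∧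
    φ (2 * Real.pi) - φ 0 = 2 * Real.pi * n

/-- The planar vector field `V` has no zero near `p`, except possibly at `p` itself, and its index
at `p` is `n`: its winding number along all small counterclockwise circles around `p` is `n`. -/
def HasIndexAt (V : ℂ → ℂ) (p : ℂ) (n : ℤ) : Prop :=
  ∀ᶠ r in 𝓝[>] (0 : ℝ), HasWindingNumber (fun θ => V (circleMap p r θ)) n

/-- `p` is an isolated conformal point of `X`, of multiplicity `n`. -/
def HasConformalMultiplicity (h : ℂ → ℂ →L[ℝ] ℂ →L[ℝ] ℝ) (X : ℂ → ℂ) (p : ℂ) (n : ℤ) : Prop :=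
  IsConformalPoint h X p ∧ HasIndexAt (conformalDefect h X) p n

end

/-!
On the boundary `dH = 0`, so the Hamiltonian field `X` vanishes there and its linearization kills the
tangent `T`. It is also trace-free, because the Hessian of `H` is symmetric, hence of the form
`v ↦ c (T × v) T` (`exists_eq_smul_of_trace_eq_zero`). Computing `L_X h` in the orthonormal frame then
shows that the field `V` of the theorem is a real multiple of `ζ²`, where `ζ` is the tangent written in
that frame (`conformalDefect_eq_mul_sq`). Since the frame is obtained from the coordinate frame by a
triangular change of basis with positive diagonal, `ζ` turns as often as `T`, and `V` turns twice as
often.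

The rest is planar topology, carried out with continuous logarithms of nowhere vanishing functions.

* Hopf's argument with secants determines the rotation number `2n + 1` of the tangent together with
  the winding numbers `n + 1` and `n` of the curve around nearby points on its two sides
  (`exists_turning_number`). Every point off the curve can be moved along a normal to such a nearby
  point, and far away the winding number is `0`. So the curve winds either `0` times or as often as
  its tangent turns.
* A function on a simple closed curve with winding number zero is `exp l` for a continuous `l` on the
  plane, by Tietze's theorem (`exists_exp_extension`). If a field on `D` agrees on the boundary with
  `exp l * (z - p) ^ k`, where `p` is interior to `D`, that formula extends it outside `D` without new
  zeros, and its indices add up to its winding number `k` along a large circle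
  (`sum_index_eq_of_frontier`).
* Applied to the constant field `1`, this shows that the boundary curve has nonzero winding number
  around interior points, which is therefore the rotation number `τ` of the tangent
  (`exists_winding_eq_turning`). Applied to `V`, whose winding number `2τ` along the boundary is that of
  `(z - p) ^ 2`, it gives the sum of the indices: `2`. The orientation of the curve does not matter.
-/

/-! ### Continuous logarithms and winding numbers -/

/-- A continuous nowhere vanishing function on a simply connected space has a continuous
logarithm. -/
theorem exists_continuous_log {X : Type*} [TopologicalSpace X] [SimplyConnectedSpace X]
    [LocallyPathConnectedSpace X] {f : X → ℂ} (hf : Continuous f) (h0 : ∀ x, f x ≠ 0) :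
    ∃ L : X → ℂ, Continuous L ∧ ∀ x, Complex.exp (L x) = f x := by
  obtain ⟨a⟩ : Nonempty X := inferInstance
  obtain ⟨F, ⟨-, hF⟩, -⟩ := Complex.isCoveringMapOn_exp.existsUnique_continuousMap_lifts
    ⟨f, hf⟩ (Complex.exp_log (h0 a)) h0
  exact ⟨F, F.continuous, fun x => congrFun hF x⟩

/-- Two continuous logarithms of the same function on a connected space differ by a constant. -/
theorem sub_eq_sub_of_exp_eq {X : Type*} [TopologicalSpace X] [PreconnectedSpace X] {L M : X → ℂ}
    (hL : Continuous L) (hM : Continuous M) (h : ∀ x, Complex.exp (L x) = Complex.exp (M x))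
    (a b : X) : L a - L b = M a - M b := by
  have h1 : ∀ x, ∃ n : ℤ, L x = M x + n * (2 * Real.pi * Complex.I) :=
    fun x => Complex.exp_eq_exp_iff_exists_int.1 (h x)
  choose n hn using h1
  have hc : Continuous n := by
    rw [Int.isClosedEmbedding_coe_real.isEmbedding.continuous_iff]
    have : ((fun k : ℤ => (k : ℝ)) ∘ n) = fun x => ((L x - M x) / (2 * Real.pi * Complex.I)).re := by
      ext x
      rw [hn x, add_sub_cancel_left, mul_div_assoc, div_self (by simp), mul_one]
      simp
    rw [this]
    exact Complex.continuous_re.comp ((hL.sub hM).div_const _)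
  have : n a = n b := PreconnectedSpace.constant inferInstance hc
  rw [hn a, hn b, this]; ring

/-- The function `f`, restricted to `[0, 1]`, is a loop in `ℂ ∖ {0}` of winding number `n`:
a continuous logarithm of it increases by `2πin`. -/
def HasLogWinding (f : ℝ → ℂ) (n : ℤ) : Prop :=
  ∃ L : ℝ → ℂ, Continuous L ∧ (∀ t, Complex.exp (L t) = f t) ∧
    L 1 - L 0 = n * (2 * Real.pi * Complex.I)

namespace HasLogWinding

variable {f g : ℝ → ℂ} {m n : ℤ}

theorem continuous (hf : HasLogWinding f n) : Continuous f := by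
  obtain ⟨L, hL, hLf, -⟩ := hf
  rw [← funext hLf]; exact Complex.continuous_exp.comp hL

theorem ne_zero (hf : HasLogWinding f n) (t : ℝ) : f t ≠ 0 := by
  obtain ⟨L, hL, hLf, -⟩ := hf
  rw [← hLf]; exact Complex.exp_ne_zero _

theorem unique (hm : HasLogWinding f m) (hn : HasLogWinding f n) : m = n := by
  obtain ⟨L, hL, hLf, h1⟩ := hm
  obtain ⟨M, hM, hMf, h2⟩ := hn
  have := sub_eq_sub_of_exp_eq hL hM (fun t => by rw [hLf, hMf]) 1 0
  rw [h1, h2] at this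
  exact_mod_cast mul_right_cancel₀ Complex.two_pi_I_ne_zero this

theorem mul (hf : HasLogWinding f m) (hg : HasLogWinding g n) :
    HasLogWinding (fun t => f t * g t) (m + n) := by
  obtain ⟨L, hL, hLf, h1⟩ := hf
  obtain ⟨M, hM, hMf, h2⟩ := hg
  refine ⟨fun t => L t + M t, hL.add hM, fun t => by rw [Complex.exp_add, hLf, hMf], ?_⟩
  push_cast
  linear_combination h1 + h2

theorem zpow (hf : HasLogWinding f n) (k : ℤ) : HasLogWinding (fun t => f t ^ k) (k * n) := by
  obtain ⟨L, hL, hLf, h1⟩ := hf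
  refine ⟨fun t => k * L t, continuous_const.mul hL, fun t => by rw [Complex.exp_int_mul, hLf], ?_⟩
  push_cast
  linear_combination (k : ℂ) * h1

theorem div (hf : HasLogWinding f m) (hg : HasLogWinding g n) :
    HasLogWinding (fun t => f t / g t) (m - n) := by
  have := hf.mul (hg.zpow (-1))
  simpa [div_eq_mul_inv, sub_eq_add_neg] using this

theorem exp {l : ℝ → ℂ} (hl : Continuous l) (h : l 1 = l 0) :
    HasLogWinding (fun t => Complex.exp (l t)) 0 :=
  ⟨l, hl, fun _ => rfl, by simp [h]⟩

theorem of_slitPlane (hf : Continuous f) (h : ∀ t, f t ∈ Complex.slitPlane) (h1 : f 1 = f 0) :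
    HasLogWinding f 0 :=
  ⟨fun t => Complex.log (f t), hf.clog h,
    fun t => Complex.exp_log (Complex.slitPlane_ne_zero (h t)), by simp [h1]⟩

theorem const {c : ℂ} (hc : c ≠ 0) : HasLogWinding (fun _ => c) 0 :=
  ⟨fun _ => Complex.log c, continuous_const, fun _ => Complex.exp_log hc, by simp⟩

theorem of_div_slitPlane (hg : HasLogWinding g n) (hf : Continuous f)
    (h : ∀ t, f t / g t ∈ Complex.slitPlane) (h1 : f 1 = f 0) (h2 : g 1 = g 0) :
    HasLogWinding f n := by
  have := (of_slitPlane (hf.div hg.continuous hg.ne_zero) h (by simp [h1, h2])).mul hg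
  convert this using 1
  · ext t; exact (div_mul_cancel₀ _ (hg.ne_zero t)).symm
  · simp

theorem of_exists_log {L : ℝ → ℂ} (hL : Continuous L) (h : ∀ t, Complex.exp (L t) = f t)
    (h1 : f 1 = f 0) : ∃ n, HasLogWinding f n := by
  obtain ⟨n, hn⟩ := Complex.exp_eq_exp_iff_exists_int.1 (by rw [h, h, h1] :
    Complex.exp (L 1) = Complex.exp (L 0))
  exact ⟨n, L, hL, h, by rw [hn]; ring⟩

theorem exists_of_loop (hf : Continuous f) (h0 : ∀ t, f t ≠ 0) (h1 : f 1 = f 0) :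
    ∃ n, HasLogWinding f n := by
  obtain ⟨L, hL, hLf⟩ := exists_continuous_log hf h0
  exact of_exists_log hL hLf h1

/-- Homotopy invariance of the winding number. -/
theorem homotopy {F : ℝ → ℝ → ℂ} (hF : Continuous fun p : ℝ × ℝ => F p.1 p.2)
    (h0 : ∀ s t, F s t ≠ 0) (h1 : ∀ s, F s 1 = F s 0) {a : ℝ} (h : HasLogWinding (F a) n) (b : ℝ) :
    HasLogWinding (F b) n := by
  obtain ⟨L, hL, hLf⟩ := exists_continuous_log hF fun p => h0 p.1 p.2
  have hs : ∀ s, Continuous fun t => L (s, t) := fun s => hL.comp (by fun_prop)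
  have ht : ∀ t, Continuous fun s => L (s, t) := fun t => hL.comp (by fun_prop)
  have key := sub_eq_sub_of_exp_eq (ht 1) (ht 0) (fun s => by rw [hLf, hLf, h1]) a b
  obtain ⟨M, hM, hMf, h2⟩ := h
  have := sub_eq_sub_of_exp_eq (hs a) hM (fun t => by rw [hLf, hMf]) 1 0
  exact ⟨fun t => L (b, t), hs b, fun t => hLf (b, t), by linear_combination this + h2 - key⟩

theorem comp_add_right (h : HasLogWinding f n) (hp : Function.Periodic f 1) (s : ℝ) :
    HasLogWinding (fun t => f (t + s)) n := by
  refine homotopy (F := fun s t => f (t + s)) (a := 0) ?_ (fun s t => h.ne_zero _) (fun s => ?_)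
    (by simpa using h) s
  · exact h.continuous.comp (by fun_prop)
  · simp only [zero_add]; rw [add_comm, hp]

/-- A continuous logarithm of a periodic function of winding number zero can be chosen periodic. -/
theorem exists_periodic_log (h : HasLogWinding f 0) (hp : Function.Periodic f 1) :
    ∃ L : ℝ → ℂ, Continuous L ∧ (∀ t, Complex.exp (L t) = f t) ∧ Function.Periodic L 1 := by
  obtain ⟨L, hL, hLf, h1⟩ := h
  refine ⟨L, hL, hLf, fun t => ?_⟩
  have := sub_eq_sub_of_exp_eq (L := fun t => L (t + 1)) (M := L) (hL.comp (by fun_prop)) hL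
    (fun t => by rw [hLf, hLf, hp]) t 0
  simp only [zero_add] at this
  simp only [Int.cast_zero, zero_mul] at h1
  linear_combination this + h1

theorem hasWindingNumber (h : HasLogWinding (fun t => f (2 * Real.pi * t)) n) :
    HasWindingNumber f n := by
  have hpi : 2 * Real.pi ≠ 0 := Real.two_pi_pos.ne'
  have e : ∀ t, 2 * Real.pi * (t / (2 * Real.pi)) = t := fun t => by field_simp
  obtain ⟨L, hL, hLf, h1⟩ := id h
  have hLf' : ∀ t, Complex.exp (L (t / (2 * Real.pi))) = f t := fun t => by
    simpa only [e] using hLf (t / (2 * Real.pi))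
  refine ⟨fun t => by rw [← hLf']; exact Complex.exp_ne_zero _,
    fun t => (L (t / (2 * Real.pi))).im, ?_, fun t => ?_, ?_⟩
  · exact Complex.continuous_im.comp (hL.comp (by fun_prop))
  · rw [← hLf', Complex.norm_exp, Complex.ofReal_exp, ← Complex.exp_add, Complex.re_add_im]
  · have := congrArg Complex.im h1
    simp only [div_self hpi, zero_div]
    simp at this
    linarith

end HasLogWinding

/-- Two parameters of the same point on a simple closed curve differ by an integer. -/
theorem Function.Periodic.exists_int_of_injOn {c : ℝ → ℂ} (hp : Function.Periodic c 1)
    (hi : InjOn c (Ico 0 1)) {s t : ℝ} (h : c s = c t) : ∃ n : ℤ, s = t + n := by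
  have hf : ∀ t, c (Int.fract t) = c t := fun t => by
    rw [Int.fract]
    simpa using hp.sub_int_mul_eq ⌊t⌋ (x := t)
  have := hi ⟨Int.fract_nonneg s, Int.fract_lt_one s⟩ ⟨Int.fract_nonneg t, Int.fract_lt_one t⟩
    (by rw [hf, hf, h])
  obtain ⟨n, hn⟩ := Int.fract_eq_fract.1 this
  exact ⟨n, by linarith⟩

theorem Function.Periodic.range_eq_image_Icc {c : ℝ → ℂ} (hp : Function.Periodic c 1) :
    range c = c '' Icc 0 1 := by
  simpa using (hp.image_Icc one_pos 0).symm

/-- A function of winding number zero on a simple closed curve is the restriction of the exponential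
of a continuous function on the whole plane: its logarithm descends to the curve, a compact quotient
of the parameter line, and Tietze's theorem extends it. -/
theorem exists_exp_extension {c g : ℝ → ℂ} (hc : Continuous c) (hp : Function.Periodic c 1)
    (hi : InjOn c (Ico 0 1)) (hg : HasLogWinding g 0) (hgp : Function.Periodic g 1) :
    ∃ l : ℂ → ℂ, Continuous l ∧ ∀ t, Complex.exp (l (c t)) = g t := by
  obtain ⟨L, hL, hLg, hLp⟩ := hg.exists_periodic_log hgp
  have hcomp : IsCompact (range c) := by
    rw [hp.range_eq_image_Icc]; exact isCompact_Icc.image hc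
  let q : Icc (0 : ℝ) 1 → range c := fun t => ⟨c t, mem_range_self _⟩
  have hq : Continuous q := Continuous.subtype_mk (hc.comp continuous_subtype_val) _
  have hqs : Function.Surjective q := by
    rintro ⟨z, hz⟩
    rw [hp.range_eq_image_Icc] at hz
    obtain ⟨t, ht, rfl⟩ := hz
    exact ⟨⟨t, ht⟩, rfl⟩
  have hquot : IsQuotientMap q := hq.isClosedMap.isQuotientMap hq hqs
  have hLc : ∀ s t, c s = c t → L s = L t := by
    intro s t h
    obtain ⟨n, rfl⟩ := hp.exists_int_of_injOn hi h
    simpa using hLp.int_mul n t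
  let F : range c → ℂ := fun z => L (Classical.choose z.2)
  have hFq : ∀ t, F ⟨c t, mem_range_self t⟩ = L t := fun t =>
    hLc _ _ (Classical.choose_spec (mem_range_self (f := c) t))
  have hF : Continuous F := by
    rw [hquot.continuous_iff]
    have : F ∘ q = fun t : Icc (0 : ℝ) 1 => L t := funext fun t => hFq t
    rw [this]; exact hL.comp continuous_subtype_val
  obtain ⟨l, hl⟩ := ContinuousMap.exists_restrict_eq hcomp.isClosed ⟨F, hF⟩
  refine ⟨l, l.continuous, fun t => ?_⟩
  have := congrArg (fun φ => φ ⟨c t, mem_range_self t⟩) hl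
  simp only [ContinuousMap.restrict_apply, ContinuousMap.coe_mk, hFq] at this
  rw [this, hLg]

/-! ### Indices of planar fields -/

theorem continuous_circleMap_two_pi (p : ℂ) (r : ℝ) :
    Continuous fun t : ℝ => circleMap p r (2 * Real.pi * t) :=
  (continuous_circleMap p r).comp (by fun_prop)

theorem circleMap_two_pi_periodic (p : ℂ) (r : ℝ) :
    Function.Periodic (fun t : ℝ => circleMap p r (2 * Real.pi * t)) 1 := fun t => by
  simpa [mul_add] using periodic_circleMap p r (2 * Real.pi * t)

theorem circleMap_two_pi_injOn (p : ℂ) {r : ℝ} (hr : r ≠ 0) :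
    InjOn (fun t : ℝ => circleMap p r (2 * Real.pi * t)) (Ico 0 1) := by
  intro s hs t ht h
  have hr' : (r : ℂ) ≠ 0 := by exact_mod_cast hr
  obtain ⟨n, hn⟩ := Complex.exp_eq_exp_iff_exists_int.1 (mul_left_cancel₀ hr' (add_left_cancel h))
  have h2 : (s : ℂ) = t + n := by
    have h3 := Complex.two_pi_I_ne_zero
    refine mul_left_cancel₀ h3 ?_
    push_cast at hn
    linear_combination hn
  have h3 : s = t + n := by exact_mod_cast h2
  have h4 : (n : ℝ) < 1 := by linarith [hs.2, ht.1]
  have h5 : (-1 : ℝ) < n := by linarith [hs.1, ht.2]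
  have h6 : n < 1 := by exact_mod_cast h4
  have h7 : -1 < n := by exact_mod_cast h5
  obtain rfl : n = 0 := by omega
  simpa using h3

theorem norm_circleMap_sub_center (p : ℂ) {r : ℝ} (hr : 0 < r) (t : ℝ) :
    ‖circleMap p r t - p‖ = r := by
  rw [circleMap_sub_center, norm_circleMap_zero, abs_of_pos hr]

theorem mem_ball_circleMap {p : ℂ} {r R t : ℝ} (hr : 0 < r) (hR : r < R) :
    circleMap p r t ∈ Metric.ball p R := by
  simpa [circleMap, abs_of_pos hr]

/-- The winding number along a small circle around an isolated zero does not depend on the radius,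
since the concentric circles are homotopic in the punctured disc. -/
theorem exists_winding_circleMap {V : ℂ → ℂ} {p : ℂ} {R : ℝ}
    (hV : ContinuousOn V (Metric.ball p R)) (h0 : ∀ z ∈ Metric.ball p R, z ≠ p → V z ≠ 0) :
    ∃ n : ℤ, ∀ r, 0 < r → r < R →
      HasLogWinding (fun t => V (circleMap p r (2 * Real.pi * t))) n := by
  have hne : ∀ r t, 0 < r → circleMap p r t ≠ p := fun r t hr => circleMap_ne_center hr.ne'
  rcases le_or_gt R 0 with hR | hR
  · exact ⟨0, fun r h1 h2 => absurd h2 (by linarith)⟩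
  have hloop : ∀ r, V (circleMap p r (2 * Real.pi * 1)) = V (circleMap p r (2 * Real.pi * 0)) :=
    fun r => by simp [circleMap]
  have hex : ∀ r, 0 < r → r < R →
      ∃ n, HasLogWinding (fun t => V (circleMap p r (2 * Real.pi * t))) n := fun r h1 h2 =>
    HasLogWinding.exists_of_loop (hV.comp_continuous (continuous_circleMap_two_pi p r)
      fun t => mem_ball_circleMap h1 h2)
      (fun t => h0 _ (mem_ball_circleMap h1 h2) (hne _ _ h1)) (hloop r)
  obtain ⟨n, hn⟩ := hex (R / 2) (by linarith) (by linarith)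
  refine ⟨n, fun r h1 h2 => ?_⟩
  -- `k` moves its argument into the interval between `r` and `R / 2`
  set k : ℝ → ℝ := fun s => max (min r (R / 2)) (min (max r (R / 2)) s) with hk
  have hk0 : ∀ s, 0 < k s := fun s => lt_max_of_lt_left (lt_min h1 (by linarith))
  have hkR : ∀ s, k s < R := fun s => max_lt (min_lt_of_left_lt h2)
    (min_lt_of_left_lt (max_lt h2 (by linarith)))
  have hkr : k r = r := by simp [hk]
  have hkR2 : k (R / 2) = R / 2 := by simp [hk]
  have := HasLogWinding.homotopy (F := fun s t => V (circleMap p (k s) (2 * Real.pi * t)))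
    (a := R / 2) (n := n) ?_ (fun s t => h0 _ (mem_ball_circleMap (hk0 s) (hkR s))
      (hne _ _ (hk0 s))) (fun s => hloop _) (by simpa only [hkR2] using hn) r
  · simpa only [hkr] using this
  · refine hV.comp_continuous ?_ fun x => mem_ball_circleMap (hk0 _) (hkR _)
    unfold circleMap
    fun_prop

theorem winding_circleMap_sub_center (p : ℂ) {r : ℝ} (hr : r ≠ 0) :
    HasLogWinding (fun t => circleMap p r (2 * Real.pi * t) - p) 1 := by
  refine ⟨fun t => Complex.log r + t * (2 * Real.pi * Complex.I), by fun_prop, fun t => ?_, by simp⟩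
  rw [Complex.exp_add, Complex.exp_log (by exact_mod_cast hr)]
  simp only [circleMap, add_sub_cancel_left]
  push_cast
  ring_nf

theorem one_add_mem_slitPlane {z : ℂ} (hz : ‖z‖ < 1) : 1 + z ∈ Complex.slitPlane :=
  Complex.mem_slitPlane_of_norm_lt_one hz

theorem winding_circleMap_sub_of_norm_lt (p q : ℂ) {r : ℝ} (h : ‖p - q‖ < r) :
    HasLogWinding (fun t => circleMap p r (2 * Real.pi * t) - q) 1 := by
  have hr : 0 < r := (norm_nonneg _).trans_lt h
  refine (winding_circleMap_sub_center p hr.ne').of_div_slitPlane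
    ((continuous_circleMap_two_pi p r).sub continuous_const) (fun t => ?_)
    (by simp [circleMap]) (by simp [circleMap])
  have hne : circleMap p r (2 * Real.pi * t) - p ≠ 0 := sub_ne_zero.2 (circleMap_ne_center hr.ne')
  rw [show circleMap p r (2 * Real.pi * t) - q = circleMap p r (2 * Real.pi * t) - p + (p - q) by
    ring, add_div, div_self hne]
  refine one_add_mem_slitPlane ?_
  rwa [norm_div, div_lt_one (norm_pos_iff.2 hne), norm_circleMap_sub_center p hr]

theorem winding_circleMap_sub_of_lt_norm (p q : ℂ) {r : ℝ} (hr : 0 < r) (h : r < ‖p - q‖) :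
    HasLogWinding (fun t => circleMap p r (2 * Real.pi * t) - q) 0 := by
  have hpq : p - q ≠ 0 := norm_pos_iff.1 (hr.trans h)
  refine (HasLogWinding.const hpq).of_div_slitPlane
    ((continuous_circleMap_two_pi p r).sub continuous_const) (fun t => ?_)
    (by simp [circleMap]) rfl
  rw [show circleMap p r (2 * Real.pi * t) - q = p - q + (circleMap p r (2 * Real.pi * t) - p) by
    ring, add_div, div_self hpq]
  refine one_add_mem_slitPlane ?_
  rwa [norm_div, div_lt_one (norm_pos_iff.2 hpq), norm_circleMap_sub_center p hr]

/-- A continuous planar field with finitely many zeros has, along every large circle, the winding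
number given by the sum of its indices. Dividing by `(z - p) ^ m p` and refilling a small disc around
`p` removes the zero `p`; a field without zeros has a global logarithm. -/
theorem winding_circleMap_eq_sum_index (Z : Finset ℂ) (m : ℂ → ℤ) : ∀ {V : ℂ → ℂ},
    Continuous V → (∀ z ∉ Z, V z ≠ 0) →
    (∀ p ∈ Z, ∀ᶠ r in 𝓝[>] (0 : ℝ),
      HasLogWinding (fun t => V (circleMap p r (2 * Real.pi * t))) (m p)) →
    ∀ᶠ R in atTop, HasLogWinding (fun t => V (circleMap 0 R (2 * Real.pi * t))) (∑ p ∈ Z, m p) := by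
  induction Z using Finset.induction with
  | empty =>
    intro V hV h0 _
    obtain ⟨l, hl, hlV⟩ := exists_continuous_log hV fun z => h0 z (by simp)
    refine Eventually.of_forall fun R => ?_
    simp_rw [← hlV]
    exact HasLogWinding.exp (hl.comp (continuous_circleMap_two_pi 0 R)) (by simp [circleMap])
  | insert p Z hp ih =>
    intro V hV h0 hm
    have hZ : ∀ᶠ r in 𝓝[>] (0 : ℝ), ∀ q ∈ Z, r < dist q p := by
      rw [Filter.eventually_all_finset]
      intro q hq
      have : 0 < dist q p := dist_pos.2 (fun h => hp (h ▸ hq))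
      exact mem_nhdsWithin_of_mem_nhds (Iio_mem_nhds this)
    obtain ⟨r, ⟨hr1, hrZ⟩, hr0⟩ :=
      (((hm p (Finset.mem_insert_self _ _)).and hZ).and self_mem_nhdsWithin).exists
    have hr0 : 0 < r := hr0
    have hquot := hr1.div ((winding_circleMap_sub_center p hr0.ne').zpow (m p))
    rw [mul_one, sub_self] at hquot
    obtain ⟨l, hl, hlV⟩ := exists_exp_extension (continuous_circleMap_two_pi p r)
      (circleMap_two_pi_periodic p r) (circleMap_two_pi_injOn p hr0.ne') hquot (fun t => by
        simp only [circleMap_two_pi_periodic p r t])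
    classical
    set W : ℂ → ℂ := (Metric.closedBall p r).piecewise (fun z => Complex.exp (l z))
      (fun z => V z / (z - p) ^ m p) with hW
    have hWout : ∀ z, z ∉ Metric.closedBall p r → W z = V z / (z - p) ^ m p :=
      fun z hz => piecewise_eq_of_notMem _ _ _ hz
    have hWc : Continuous W := by
      refine continuous_piecewise ?_ (Complex.continuous_exp.comp hl).continuousOn ?_
      · intro z hz
        rw [frontier_closedBall p hr0.ne'] at hz
        obtain ⟨θ, hθ⟩ : z ∈ range (circleMap p r) := by
          rwa [range_circleMap, abs_of_pos hr0]
        have := hlV (θ / (2 * Real.pi))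
        rw [mul_div_cancel₀ _ Real.two_pi_pos.ne', hθ] at this
        exact this
      · rw [closure_compl, interior_closedBall p hr0.ne']
        refine hV.continuousOn.div ((continuousOn_id.sub continuousOn_const).zpow₀ _ ?_) ?_
        · intro z hz
          left
          intro h
          have h : z = p := sub_eq_zero.1 h
          exact hz (by simp [h, hr0])
        · intro z hz
          refine zpow_ne_zero _ fun h => hz (by simp [sub_eq_zero.1 h, hr0])
    have hsub : ∀ z, z ∉ Metric.closedBall p r → z - p ≠ 0 := fun z hz h =>
      hz (by simp [sub_eq_zero.1 h, hr0.le])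
    have hW0 : ∀ z ∉ Z, W z ≠ 0 := by
      intro z hz
      by_cases hzr : z ∈ Metric.closedBall p r
      · rw [hW, piecewise_eq_of_mem _ _ _ hzr]; exact Complex.exp_ne_zero _
      · rw [hWout z hzr]
        refine div_ne_zero (h0 z ?_) (zpow_ne_zero _ (hsub z hzr))
        rw [Finset.mem_insert, not_or]
        exact ⟨sub_ne_zero.1 (hsub z hzr), hz⟩
    have hWm : ∀ q ∈ Z, ∀ᶠ s in 𝓝[>] (0 : ℝ),
        HasLogWinding (fun t => W (circleMap q s (2 * Real.pi * t))) (m q) := by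
      intro q hq
      have hd : 0 < dist q p - r := sub_pos.2 (hrZ q hq)
      filter_upwards [hm q (Finset.mem_insert_of_mem hq), self_mem_nhdsWithin,
        mem_nhdsWithin_of_mem_nhds (Iio_mem_nhds hd)] with s hs hs0 hsd
      have hs0 : 0 < s := hs0
      have hsd : s < dist q p - r := hsd
      have hfar := winding_circleMap_sub_of_lt_norm q p hs0
        (by rw [← dist_eq_norm]; linarith)
      have := hs.div (hfar.zpow (m p))
      rw [mul_zero, sub_zero] at this
      convert this using 2 with t
      refine hWout _ fun h => ?_
      have h1 : dist (circleMap q s (2 * Real.pi * t)) q = s := by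
        rw [dist_eq_norm, norm_circleMap_sub_center q hs0]
      have h2 := dist_triangle_left q p (circleMap q s (2 * Real.pi * t))
      have h3 : dist (circleMap q s (2 * Real.pi * t)) p ≤ r := h
      linarith
    filter_upwards [ih hWc hW0 hWm, eventually_gt_atTop (r + ‖p‖)] with R hR hRr
    have hnear := winding_circleMap_sub_of_norm_lt 0 p (r := R) (by
      rw [zero_sub, norm_neg]; linarith)
    have := hR.mul (hnear.zpow (m p))
    rw [mul_one] at this
    rw [Finset.sum_insert hp, add_comm]
    convert this using 2 with t
    have hz : circleMap 0 R (2 * Real.pi * t) ∉ Metric.closedBall p r := by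
      intro h
      have h1 : ‖circleMap 0 R (2 * Real.pi * t)‖ = R := by
        simp [abs_of_pos (by linarith [norm_nonneg p] : 0 < R)]
      have h2 := norm_sub_norm_le (circleMap 0 R (2 * Real.pi * t)) p
      rw [mem_closedBall_iff_norm] at h
      linarith
    rw [hWout _ hz, div_mul_cancel₀ _ (zpow_ne_zero _ (hsub _ hz))]

/-- If, on the boundary of the bounded closed set `D`, the field `V` is `exp l * (z - p) ^ k` with
`p` interior to `D`, then the indices of `V` in `D` add up to `k`: that expression extends `V` to the
whole plane without new zeros. -/
theorem sum_index_eq_of_frontier {D : Set ℂ} (hDc : IsClosed D) (hDb : Bornology.IsBounded D)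
    {p : ℂ} (hp : p ∈ interior D) {V l : ℂ → ℂ} (hV : ContinuousOn V D) (hl : Continuous l) {k : ℤ}
    (hfr : ∀ z ∈ frontier D, V z = Complex.exp (l z) * (z - p) ^ k)
    (Z : Finset ℂ) (m : ℂ → ℤ) (hZD : ∀ q ∈ Z, q ∈ interior D) (h0 : ∀ z ∈ D, z ∉ Z → V z ≠ 0)
    (hm : ∀ q ∈ Z, ∀ᶠ r in 𝓝[>] (0 : ℝ),
      HasLogWinding (fun t => V (circleMap q r (2 * Real.pi * t))) (m q)) :
    ∑ q ∈ Z, m q = k := by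
  classical
  set W : ℂ → ℂ := D.piecewise V (fun z => Complex.exp (l z) * (z - p) ^ k) with hW
  have hpne : ∀ z, z ∉ interior D → z - p ≠ 0 := fun z hz h => hz (sub_eq_zero.1 h ▸ hp)
  have hWc : Continuous W := by
    refine continuous_piecewise hfr (by rwa [hDc.closure_eq]) ?_
    rw [closure_compl]
    exact (Complex.continuous_exp.comp hl).continuousOn.mul
      ((continuousOn_id.sub continuousOn_const).zpow₀ _ fun z hz => Or.inl (hpne z hz))
  have hW0 : ∀ z ∉ Z, W z ≠ 0 := by
    intro z hz
    by_cases hzD : z ∈ D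
    · rw [hW, piecewise_eq_of_mem _ _ _ hzD]; exact h0 z hzD hz
    · rw [hW, piecewise_eq_of_notMem _ _ _ hzD]
      exact mul_ne_zero (Complex.exp_ne_zero _)
        (zpow_ne_zero _ (hpne z fun h => hzD (interior_subset h)))
  have hWm : ∀ q ∈ Z, ∀ᶠ r in 𝓝[>] (0 : ℝ),
      HasLogWinding (fun t => W (circleMap q r (2 * Real.pi * t))) (m q) := by
    intro q hq
    obtain ⟨ε, hε, hεD⟩ := Metric.isOpen_iff.1 isOpen_interior q (hZD q hq)
    filter_upwards [hm q hq, self_mem_nhdsWithin, mem_nhdsWithin_of_mem_nhds (Iio_mem_nhds hε)]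
      with r hr hr0 hrε
    convert hr using 2 with t
    exact piecewise_eq_of_mem _ _ _ (interior_subset (hεD (mem_ball_circleMap hr0 hrε)))
  obtain ⟨C, hC⟩ := hDb.subset_closedBall 0
  obtain ⟨R, ⟨h1, h2⟩, h3⟩ := (((winding_circleMap_eq_sum_index Z m hWc hW0 hWm).and
    (eventually_gt_atTop (max C ‖p‖))).and (eventually_gt_atTop 0)).exists
  have hexp := HasLogWinding.exp (hl.comp (continuous_circleMap_two_pi 0 R)) (by simp [circleMap])
  have hout := hexp.mul ((winding_circleMap_sub_of_norm_lt 0 p (r := R) (by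
    rw [zero_sub, norm_neg]; exact (le_max_right _ _).trans_lt h2)).zpow k)
  rw [mul_one, zero_add] at hout
  refine h1.unique ?_
  convert hout using 2 with t
  refine piecewise_eq_of_notMem _ _ _ fun h => ?_
  have := hC h
  rw [mem_closedBall_zero_iff, norm_circleMap_zero, abs_of_pos h3] at this
  exact absurd ((le_max_left C ‖p‖).trans_lt h2) (not_lt.2 this)

/-! ### Rotation of the tangent of a simple closed curve -/

/-- The quotient `(γ (s + u) - γ s) / (u (1 - u))` of a curve `γ` of period `1`, in a form that is
continuous for all `s` and `u`. -/
noncomputable def secantQuotient (γ : ℝ → ℂ) (s u : ℝ) : ℂ :=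
  (∫ x in (0 : ℝ)..1, deriv γ (s + x * u)) - ∫ x in (0 : ℝ)..1, deriv γ (s + 1 + x * (u - 1))

section Hopf

variable {γ : ℝ → ℂ} (hγ : ContDiff ℝ ∞ γ) (hp : Function.Periodic γ 1)

include hγ in
theorem continuous_secantQuotient :
    Continuous fun p : ℝ × ℝ => secantQuotient γ p.1 p.2 := by
  have hd : Continuous (deriv γ) := hγ.continuous_deriv (by simp)
  refine Continuous.sub ?_ ?_ <;>
  · refine intervalIntegral.continuous_parametric_intervalIntegral_of_continuous' ?_ 0 1
    exact hd.comp (by fun_prop)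

include hγ in
theorem mul_integral_deriv (s u : ℝ) :
    (u : ℂ) * ∫ x in (0 : ℝ)..1, deriv γ (s + x * u) = γ (s + u) - γ s := by
  have hd : Continuous (deriv γ) := hγ.continuous_deriv (by simp)
  have := intervalIntegral.integral_unitInterval_deriv_eq_sub (f := γ) (f' := deriv γ) (z₀ := s)
    (z₁ := u) (hd.comp (by fun_prop)).continuousOn
    (fun t _ => (hγ.differentiable (by simp)).differentiableAt.hasDerivAt)
  rw [← this]
  simp

include hγ hp in
theorem mul_secantQuotient (s u : ℝ) :
    (u : ℂ) * (1 - u) * secantQuotient γ s u = γ (s + u) - γ s := by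
  have h1 := mul_integral_deriv hγ s u
  have h2 := mul_integral_deriv hγ (s + 1) (u - 1)
  rw [hp, show s + 1 + (u - 1) = s + u by ring] at h2
  push_cast at h2
  unfold secantQuotient
  linear_combination (1 - u : ℂ) * h1 + (u : ℂ) * h2

include hγ hp in
theorem secantQuotient_zero (s : ℝ) : secantQuotient γ s 0 = deriv γ s := by
  have h2 := mul_integral_deriv hγ (s + 1) (0 - 1)
  rw [hp, show s + 1 + (0 - 1) = s by ring, sub_self] at h2
  have h3 : ∫ x in (0 : ℝ)..1, deriv γ (s + 1 + x * (0 - 1)) = 0 := by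
    simpa using h2
  rw [secantQuotient, h3]
  simp

theorem Function.Periodic.deriv_periodic (hp : Function.Periodic γ 1) :
    Function.Periodic (deriv γ) 1 := fun t => by
  rw [← deriv_comp_add_const, show (fun x => γ (x + 1)) = γ from funext hp]

include hγ hp in
theorem secantQuotient_one (s : ℝ) : secantQuotient γ s 1 = -deriv γ s := by
  have h2 := mul_integral_deriv hγ s 1
  rw [hp, sub_self] at h2
  have h3 : ∫ x in (0 : ℝ)..1, deriv γ (s + x * 1) = 0 := by
    simpa using h2
  rw [secantQuotient, h3]
  simp [hp.deriv_periodic s]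

include hγ hp in
theorem secantQuotient_ne_zero (hi : InjOn γ (Ico 0 1)) (hd : ∀ t, deriv γ t ≠ 0) (s : ℝ) {u : ℝ}
    (hu : u ∈ Icc (0 : ℝ) 1) : secantQuotient γ s u ≠ 0 := by
  rcases hu.1.eq_or_lt with rfl | h0
  · rw [secantQuotient_zero hγ hp]; exact hd s
  rcases hu.2.eq_or_lt with rfl | h1
  · rw [secantQuotient_one hγ hp]; exact neg_ne_zero.2 (hd s)
  intro h
  have := mul_secantQuotient hγ hp s u
  rw [h, mul_zero, eq_comm, sub_eq_zero] at this
  obtain ⟨n, hn⟩ := hp.exists_int_of_injOn hi this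
  have hn' : u = n := by linarith
  rw [hn'] at h0 h1
  have : 0 < n := by exact_mod_cast h0
  have : n < 1 := by exact_mod_cast h1
  omega

include hγ hp in
/-- Exchanging the end points of a chord reverses it. -/
theorem secantQuotient_symm (s : ℝ) {u : ℝ} (hu : u ∈ Icc (0 : ℝ) 1) :
    secantQuotient γ (s + (1 - u)) u = -secantQuotient γ s (1 - u) := by
  rcases hu.1.eq_or_lt with rfl | h0
  · simp only [sub_zero]
    rw [secantQuotient_zero hγ hp, secantQuotient_one hγ hp, hp.deriv_periodic, neg_neg]
  rcases hu.2.eq_or_lt with rfl | h1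
  · simp only [sub_self, add_zero]
    rw [secantQuotient_zero hγ hp, secantQuotient_one hγ hp]
  have e1 := mul_secantQuotient hγ hp (s + (1 - u)) u
  have e2 := mul_secantQuotient hγ hp s (1 - u)
  rw [show s + (1 - u) + u = s + 1 by ring, hp] at e1
  push_cast at e2
  have h0' : (u : ℂ) ≠ 0 := by exact_mod_cast h0.ne'
  have h1' : (1 - u : ℂ) ≠ 0 := by
    rw [sub_ne_zero]; exact_mod_cast h1.ne'
  refine mul_left_cancel₀ (mul_ne_zero h0' h1') ?_
  linear_combination e1 + e2

/-- The point `u` moved into `[0, 1]`. -/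
noncomputable def clampUnit (u : ℝ) : ℝ := max 0 (min u 1)

theorem continuous_clampUnit : Continuous clampUnit := by unfold clampUnit; fun_prop

theorem clampUnit_mem (u : ℝ) : clampUnit u ∈ Icc (0 : ℝ) 1 :=
  ⟨le_max_left _ _, max_le zero_le_one (min_le_right _ _)⟩

theorem clampUnit_of_mem {u : ℝ} (hu : u ∈ Icc (0 : ℝ) 1) : clampUnit u = u := by
  rw [clampUnit, min_eq_left hu.2, max_eq_right hu.1]

@[simp] theorem clampUnit_zero : clampUnit 0 = 0 := by simp [clampUnit]

@[simp] theorem clampUnit_one : clampUnit 1 = 1 := by simp [clampUnit]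

/-- The curve `u (1 - u) - δ i e u`, where `e` runs from `1` to `-1`, avoids the negative real axis
if `δ` is small: it can meet the real axis only where `e u` is imaginary, that is, away from the end
points, and there the first summand dominates. -/
theorem exists_perturbation_mem_slitPlane {e : ℝ → ℂ} (he : Continuous e) (h0 : e 0 = 1)
    (h1 : e 1 = -1) : ∃ ε₀ > 0, ∀ δ : ℝ, δ ≠ 0 → |δ| < ε₀ → ∀ u ∈ Icc (0 : ℝ) 1,
      (u * (1 - u) : ℂ) - δ * Complex.I * e u ∈ Complex.slitPlane := by
  have hK : IsCompact (Icc (0 : ℝ) 1 ∩ {u | (e u).re = 0}) :=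
    isCompact_Icc.inter_right (isClosed_eq (Complex.continuous_re.comp he) continuous_const)
  have hpos : ∀ u ∈ Icc (0 : ℝ) 1 ∩ {u | (e u).re = 0}, 0 < u * (1 - u) / (1 + |(e u).im|) := by
    rintro u ⟨hu, hre⟩
    have hu0 : u ≠ 0 := by rintro rfl; simp [h0] at hre
    have hu1 : u ≠ 1 := by rintro rfl; simp [h1] at hre
    have := hu.1.lt_of_ne' hu0
    have := sub_pos.2 (hu.2.lt_of_ne hu1)
    positivity
  obtain ⟨ε₀, hε, hle⟩ := hK.exists_forall_le' (f := fun u => u * (1 - u) / (1 + |(e u).im|))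
    (Continuous.continuousOn (Continuous.div (by fun_prop) (by fun_prop)
      fun u => by positivity)) hpos
  refine ⟨ε₀, hε, fun δ hδ hδε u hu => ?_⟩
  rw [Complex.mem_slitPlane_iff]
  by_cases hre : (e u).re = 0
  · left
    have h2 := hle u ⟨hu, hre⟩
    rw [le_div_iff₀ (by positivity)] at h2
    have h3 : |δ * (e u).im| ≤ ε₀ * |(e u).im| := by
      rw [abs_mul]; gcongr
    have h4 := abs_le.1 h3
    have : ((u * (1 - u) : ℂ) - δ * Complex.I * e u).re = u * (1 - u) + δ * (e u).im := by simp
    rw [this]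
    linarith [h4.1]
  · right
    have : ((u * (1 - u) : ℂ) - δ * Complex.I * e u).im = -(δ * (e u).re) := by simp
    rw [this]
    exact neg_ne_zero.2 (mul_ne_zero hδ hre)

include hγ hp in
/-- Hopf's theorem on turning tangents, in the form of a relation between the rotation number `2n + 1`
of the tangent and the winding numbers `n + 1` and `n` of the curve around the points close to it on
its left and on its right. Both are read off from the angle through which the chord from `γ s` to
`γ (s + u)` turns. -/
theorem exists_turning_number (hi : InjOn γ (Ico 0 1)) (hd : ∀ t, deriv γ t ≠ 0) :
    ∃ n : ℤ, HasLogWinding (deriv γ) (2 * n + 1) ∧ ∀ s, ∀ᶠ ε : ℝ in 𝓝[>] 0,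
      HasLogWinding (fun t => γ t - (γ s + ε * (Complex.I * deriv γ s))) (n + 1) ∧
      HasLogWinding (fun t => γ t - (γ s - ε * (Complex.I * deriv γ s))) n := by
  obtain ⟨L, hL, hLG⟩ := exists_continuous_log
    (f := fun p : ℝ × ℝ => secantQuotient γ p.1 (clampUnit p.2))
    ((continuous_secantQuotient hγ).comp (continuous_fst.prodMk
      (continuous_clampUnit.comp continuous_snd)))
    fun p => secantQuotient_ne_zero hγ hp hi hd _ (clampUnit_mem _)
  have hLG' : ∀ s, ∀ u ∈ Icc (0 : ℝ) 1, Complex.exp (L (s, u)) = secantQuotient γ s u :=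
    fun s u hu => by simp only [hLG, clampUnit_of_mem hu]
  have hL0 : ∀ s, Complex.exp (L (s, 0)) = deriv γ s := fun s => by
    rw [hLG' s 0 (by simp), secantQuotient_zero hγ hp]
  have hL1 : ∀ s, Complex.exp (L (s, 1)) = -deriv γ s := fun s => by
    rw [hLG' s 1 (by simp), secantQuotient_one hγ hp]
  obtain ⟨n, hn⟩ := Complex.exp_eq_exp_iff_exists_int.1 (by
    rw [hL1, Complex.exp_add, hL0, Complex.exp_pi_mul_I, mul_neg_one] :
    Complex.exp (L (0, 1)) = Complex.exp (L (0, 0) + Real.pi * Complex.I))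
  -- the chord turns by the same angle for all starting points
  have hturn : ∀ s, L (s, 1) - L (s, 0) = (2 * n + 1) * (Real.pi * Complex.I) := by
    intro s
    have := sub_eq_sub_of_exp_eq (L := fun s => L (s, 1))
      (M := fun s => L (s, 0) + Real.pi * Complex.I) (hL.comp (by fun_prop))
      ((hL.comp (by fun_prop)).add continuous_const) (fun s => by
        rw [hL1, Complex.exp_add, hL0, Complex.exp_pi_mul_I, mul_neg_one]) s 0
    linear_combination this + hn
  -- by the symmetry of chords, the tangent turns twice as far as the chord from a fixed point
  refine ⟨n, ⟨fun s => L (s, 0), hL.comp (by fun_prop), hL0, ?_⟩, fun s => ?_⟩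
  · have := sub_eq_sub_of_exp_eq (L := fun u => L (0 + (1 - clampUnit u), clampUnit u))
      (M := fun u => L (0, 1 - clampUnit u) + Real.pi * Complex.I)
      (hL.comp (by have := continuous_clampUnit; fun_prop))
      ((hL.comp (by have := continuous_clampUnit; fun_prop)).add continuous_const) (fun u => by
        have hu := clampUnit_mem u
        rw [hLG' _ _ hu, Complex.exp_add, hLG' _ _ ⟨by linarith [hu.2], by linarith [hu.1]⟩,
          Complex.exp_pi_mul_I, secantQuotient_symm hγ hp 0 hu, mul_neg_one]) 0 1
    simp only [clampUnit_zero, clampUnit_one, sub_zero, sub_self, zero_add] at this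
    push_cast
    linear_combination this + 2 * hturn 0
  · set e : ℝ → ℂ := fun u => Complex.exp (L (s, 0) - L (s, u)) with he
    have hec : Continuous e := by
      have : Continuous fun u => L (s, u) := hL.comp (by fun_prop)
      fun_prop
    have he0 : e 0 = 1 := by simp [he]
    have he1 : e 1 = -1 := by
      rw [he]; simp only [Complex.exp_sub, hL0, hL1]
      rw [div_neg, div_self (hd s)]
    -- divided by the secant quotient, `γ (s + u) - (γ s + δ i γ' s)` is `u (1 - u) - δ i e u`,
    -- whose argument is the principal one, so that it increases by `π` or `-π`
    obtain ⟨ε₀, hε, hslit⟩ := exists_perturbation_mem_slitPlane hec he0 he1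
    have key : ∀ δ : ℝ, δ ≠ 0 → |δ| < ε₀ → ∀ k : ℤ,
        Complex.log (δ * Complex.I) - Complex.log (-(δ * Complex.I)) =
          (2 * (k - n) - 1) * (Real.pi * Complex.I) →
        HasLogWinding (fun t => γ t - (γ s + δ * (Complex.I * deriv γ s))) k := by
      intro δ hδ hδε k hk
      set f : ℝ → ℂ := fun t => γ t - (γ s + δ * (Complex.I * deriv γ s)) with hf
      have hfp : Function.Periodic f 1 := fun t => by simp only [hf, hp t]
      have hfc : Continuous f := hγ.continuous.sub continuous_const
      have hfac : ∀ u ∈ Icc (0 : ℝ) 1, f (u + s) =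
          secantQuotient γ s u * ((u * (1 - u) : ℂ) - δ * Complex.I * e u) := by
        intro u hu
        have h1 := mul_secantQuotient hγ hp s u
        have h2 : secantQuotient γ s u * e u = deriv γ s := by
          rw [← hLG' s u hu, he]
          simp only
          rw [← Complex.exp_add, add_sub_cancel, hL0]
        simp only [hf]
        rw [add_comm u s]
        linear_combination -h1 + δ * Complex.I * h2
      have hf0 : ∀ t, f (t + s) ≠ 0 := by
        intro t
        have h1 : f (Int.fract t + s) = f (t + s) := by
          rw [Int.fract, sub_add_eq_add_sub]
          simpa using hfp.sub_int_mul_eq ⌊t⌋ (x := t + s)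
        have hu : Int.fract t ∈ Icc (0 : ℝ) 1 := ⟨Int.fract_nonneg t, (Int.fract_lt_one t).le⟩
        rw [← h1, hfac _ hu]
        exact mul_ne_zero (secantQuotient_ne_zero hγ hp hi hd s hu)
          (Complex.slitPlane_ne_zero (hslit δ hδ hδε _ hu))
      obtain ⟨Λ, hΛ, hΛf⟩ := exists_continuous_log (f := fun t => f (t + s))
        (hfc.comp (by fun_prop)) hf0
      have hcl := continuous_clampUnit
      have hcmp := sub_eq_sub_of_exp_eq (L := fun u => Λ (clampUnit u))
        (M := fun u => L (s, clampUnit u) + Complex.log ((clampUnit u * (1 - clampUnit u) : ℂ) -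
          δ * Complex.I * e (clampUnit u))) (hΛ.comp hcl)
        ((hL.comp (by fun_prop)).add (Continuous.clog (by fun_prop)
          fun u => hslit δ hδ hδε _ (clampUnit_mem u))) (fun u => by
            rw [hΛf, hfac _ (clampUnit_mem u), Complex.exp_add, hLG' _ _ (clampUnit_mem u),
              Complex.exp_log (Complex.slitPlane_ne_zero (hslit δ hδ hδε _ (clampUnit_mem u)))]) 1 0
      simp only [clampUnit_zero, clampUnit_one, he0, he1, Complex.ofReal_one, Complex.ofReal_zero,
        sub_self, mul_zero, zero_mul, zero_sub, mul_neg, mul_one, neg_neg] at hcmp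
      have hwind : HasLogWinding (fun t => f (t + s)) k :=
        ⟨Λ, hΛ, hΛf, by linear_combination hcmp + hk + hturn s⟩
      have := hwind.comp_add_right (fun t => by
        simp only; rw [add_right_comm, hfp]) (-s)
      simpa using this
    filter_upwards [self_mem_nhdsWithin, mem_nhdsWithin_of_mem_nhds (Iio_mem_nhds hε)]
      with ε h0 h1
    have h0 : 0 < ε := h0
    have h1 : ε < ε₀ := h1
    have hl1 : Complex.log (ε * Complex.I) = Real.log ε + Real.pi / 2 * Complex.I := by
      rw [Complex.log_ofReal_mul h0 Complex.I_ne_zero, Complex.log_I]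
    have hl2 : Complex.log (-(ε * Complex.I)) = Real.log ε - Real.pi / 2 * Complex.I := by
      rw [← mul_neg, Complex.log_ofReal_mul h0 (neg_ne_zero.2 Complex.I_ne_zero), Complex.log_neg_I]
      ring
    constructor
    · refine key ε h0.ne' (by rwa [abs_of_pos h0]) (n + 1) ?_
      rw [hl1, hl2]; push_cast; ring
    · have := key (-ε) (neg_ne_zero.2 h0.ne') (by rwa [abs_neg, abs_of_pos h0]) n (by
        push_cast
        rw [neg_mul, neg_neg, hl1, hl2]; ring)
      convert this using 3
      push_cast
      ring

end Hopf

/-! ### Winding numbers around points off the curve -/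

/-- A point off the curve can be moved along a normal of the curve, without crossing it, until it is
close to the nearest point of the curve. Hence the winding number of the curve around it is one of the
two values in `exists_turning_number`. -/
theorem winding_sub_eq_or {γ : ℝ → ℂ} (hγ : ContDiff ℝ ∞ γ) (hp : Function.Periodic γ 1)
    (hd : ∀ t, deriv γ t ≠ 0) {n : ℤ}
    (hn : ∀ s, ∀ᶠ ε : ℝ in 𝓝[>] 0,
      HasLogWinding (fun t => γ t - (γ s + ε * (Complex.I * deriv γ s))) (n + 1) ∧
      HasLogWinding (fun t => γ t - (γ s - ε * (Complex.I * deriv γ s))) n)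
    {p : ℂ} (hpγ : p ∉ range γ) :
    HasLogWinding (fun t => γ t - p) (n + 1) ∨ HasLogWinding (fun t => γ t - p) n := by
  have hcomp : IsCompact (range γ) := by
    rw [hp.range_eq_image_Icc]; exact isCompact_Icc.image hγ.continuous
  obtain ⟨_, ⟨s, rfl⟩, hmin⟩ := hcomp.exists_isMinOn (range_nonempty γ)
    (f := fun z => ‖z - p‖) (by fun_prop)
  have hmin : ∀ t, ‖γ s - p‖ ≤ ‖γ t - p‖ := fun t => hmin (mem_range_self t)
  have hne : γ s - p ≠ 0 := fun h => hpγ ⟨s, sub_eq_zero.1 h⟩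
  -- the segment from `γ s` to `p` is normal to the curve
  have horth : inner ℝ (γ s - p) (deriv γ s) = 0 := by
    have h1 : HasDerivAt (fun t => γ t - p) (deriv γ s) s :=
      ((hγ.differentiable (by simp)).differentiableAt.hasDerivAt).sub_const p
    have h2 : IsLocalMin (fun t => ‖γ t - p‖ ^ 2) s :=
      Eventually.of_forall fun t => pow_le_pow_left₀ (norm_nonneg _) (hmin t) 2
    have := h2.hasDerivAt_eq_zero h1.norm_sq
    linarith
  obtain ⟨r, hr⟩ : ∃ r : ℝ, p - γ s = r * (Complex.I * deriv γ s) := by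
    refine ⟨((p - γ s) / deriv γ s).im, ?_⟩
    have hre : ((p - γ s) / deriv γ s).re = 0 := by
      rw [Complex.inner] at horth
      simp only [Complex.mul_re, Complex.conj_re, Complex.conj_im, Complex.sub_re,
        Complex.sub_im] at horth
      rw [Complex.div_re, Complex.sub_re, Complex.sub_im, ← add_div]
      rw [div_eq_zero_iff]; left; linarith
    have := Complex.re_add_im ((p - γ s) / deriv γ s)
    rw [hre, Complex.ofReal_zero, zero_add] at this
    rw [← mul_assoc, this, div_mul_cancel₀ _ (hd s)]
  have hr0 : r ≠ 0 := by
    rintro rfl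
    rw [Complex.ofReal_zero, zero_mul] at hr
    exact hne (by rw [← neg_sub, hr, neg_zero])
  -- no point of the open segment lies on the curve, as it would be closer to `p` than `γ s`
  have hmove : ∀ σ : ℝ, 0 < σ → σ ≤ 1 → ∀ k : ℤ,
      HasLogWinding (fun t => γ t - (γ s + σ * (p - γ s))) k →
      HasLogWinding (fun t => γ t - p) k := by
    intro σ hσ hσ1 k hk
    set c : ℝ → ℝ := fun x => max σ (min x 1) with hc
    have hcσ : c σ = σ := by simp [hc, hσ1]
    have hc1 : c 1 = 1 := by simp [hc, hσ1]
    have := HasLogWinding.homotopy (F := fun x t => γ t - (γ s + c x * (p - γ s))) (a := σ)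
      (n := k) ?_ ?_ (fun x => by
        have := hp 0
        rw [zero_add] at this
        rw [this]) (by simpa only [hcσ] using hk) 1
    · simpa [hc1] using this
    · have := hγ.continuous
      fun_prop
    · intro x t h
      have h1 : σ ≤ c x := le_max_left _ _
      have h2 : c x ≤ 1 := max_le hσ1 (min_le_right _ _)
      have h3 : γ t - p = ((1 - c x : ℝ) : ℂ) * (γ s - p) := by
        push_cast
        linear_combination h
      have h4 := hmin t
      rw [h3, norm_mul, Complex.norm_real, Real.norm_of_nonneg (by linarith)] at h4
      nlinarith [norm_pos_iff.2 hne]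
  obtain ⟨ε, ⟨⟨h1, h2⟩, h3⟩, h0⟩ := (((hn s).and (mem_nhdsWithin_of_mem_nhds (Iio_mem_nhds
    (abs_pos.2 hr0)))).and self_mem_nhdsWithin).exists
  have h0 : 0 < ε := h0
  have h3 : ε < |r| := h3
  have hr0' : (r : ℂ) ≠ 0 := by exact_mod_cast hr0
  rcases hr0.lt_or_gt with hneg | hpos
  · right
    rw [abs_of_neg hneg] at h3
    refine hmove (ε / -r) (div_pos h0 (by linarith)) ((div_le_one (by linarith)).2 h3.le) n ?_
    convert h2 using 3
    rw [hr]
    push_cast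
    field_simp
    ring
  · left
    rw [abs_of_pos hpos] at h3
    refine hmove (ε / r) (div_pos h0 hpos) ((div_le_one hpos).2 h3.le) (n + 1) ?_
    convert h1 using 3
    rw [hr]
    push_cast
    field_simp

/-- A closed curve has winding number zero around every point far away. -/
theorem winding_sub_of_far {γ : ℝ → ℂ} (hγ : Continuous γ) (hp : Function.Periodic γ 1) {p : ℂ}
    (h : ∀ t, ‖γ t‖ < ‖p‖) : HasLogWinding (fun t => γ t - p) 0 := by
  have hp0 : p ≠ 0 := norm_pos_iff.1 ((norm_nonneg _).trans_lt (h 0))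
  have h01 : γ 1 = γ 0 := by simpa using hp 0
  refine (HasLogWinding.const (neg_ne_zero.2 hp0)).of_div_slitPlane (hγ.sub continuous_const)
    (fun t => ?_) (by rw [h01]) rfl
  rw [sub_eq_neg_add, add_div, div_self (neg_ne_zero.2 hp0)]
  refine one_add_mem_slitPlane ?_
  rw [norm_div, norm_neg, div_lt_one (norm_pos_iff.2 hp0)]
  exact h t

/-- Around an interior point of the domain the boundary curve has the same winding number as its
tangent. The two winding numbers around points off the curve are `n + 1` and `n`; one of them is `0`,
attained far away, whereas the one around interior points is not, by `sum_index_eq_of_frontier`. -/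
theorem exists_winding_eq_turning {D : Set ℂ} (hD : IsCompact D) {γ : ℝ → ℂ}
    (hγ : ContDiff ℝ ∞ γ) (hp : Function.Periodic γ 1) (hi : InjOn γ (Ico 0 1))
    (hd : ∀ t, deriv γ t ≠ 0) (hfr : frontier D = range γ) {p : ℂ} (hpD : p ∈ interior D) :
    ∃ τ : ℤ, HasLogWinding (deriv γ) τ ∧ HasLogWinding (fun t => γ t - p) τ := by
  obtain ⟨n, hτ, hn⟩ := exists_turning_number hγ hp hi hd
  have hpγ : p ∉ range γ := by
    rw [← hfr]; exact fun h => h.2 hpD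
  -- otherwise the field `1` would equal `exp (-l) * (z - p)` on the boundary
  have hnz : ¬ HasLogWinding (fun t => γ t - p) 0 := by
    intro h0
    obtain ⟨l, hl, hlγ⟩ := exists_exp_extension hγ.continuous hp hi h0 (fun t => by rw [hp t])
    have := sum_index_eq_of_frontier hD.isClosed hD.isBounded hpD (V := fun _ => 1)
      (l := fun z => -l z) continuousOn_const hl.neg (k := 1) (fun z hz => by
        rw [hfr] at hz
        obtain ⟨t, rfl⟩ := hz
        rw [zpow_one, Complex.exp_neg, hlγ, inv_mul_cancel₀]
        exact sub_ne_zero.2 fun h => hpγ ⟨t, h⟩) ∅ 0 (by simp) (by simp) (by simp)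
    simp at this
  obtain ⟨q, hq⟩ : ∃ q : ℂ, ∀ t, ‖γ t‖ < ‖q‖ := by
    obtain ⟨C, hC⟩ := hD.isBounded.subset_closedBall 0
    refine ⟨((|C| + 1 : ℝ) : ℂ), fun t => ?_⟩
    have h1 : γ t ∈ D := hD.isClosed.frontier_subset (hfr ▸ mem_range_self t)
    have h2 := mem_closedBall_zero_iff.1 (hC h1)
    rw [Complex.norm_real, Real.norm_of_nonneg (by positivity)]
    linarith [le_abs_self C]
  have hqγ : q ∉ range γ := by
    rintro ⟨t, rfl⟩; exact (hq t).false
  have hq0 := winding_sub_of_far hγ.continuous hp hq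
  have hn0 : n + 1 = 0 ∨ n = 0 :=
    (winding_sub_eq_or hγ hp hd hn hqγ).imp (fun h => h.unique hq0) fun h => h.unique hq0
  refine ⟨2 * n + 1, hτ, ?_⟩
  rcases winding_sub_eq_or hγ hp hd hn hpγ with h | h
  · rcases hn0 with h0 | rfl
    · rw [h0] at h; exact absurd h hnz
    · simpa using h
  · rcases hn0 with h0 | rfl
    · obtain rfl : n = -1 := by omega
      simpa using h
    · exact absurd h hnz

/-! ### The conformal defect of a Hamiltonian field along critical points -/

section Smoothness

variable {h : ℂ → ℂ →L[ℝ] ℂ →L[ℝ] ℝ} {U : Set ℂ}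

theorem IsRiemannianMetricOn.contDiffOn_apply (hh : IsRiemannianMetricOn h U) (u v : ℂ) :
    ContDiffOn ℝ ∞ (fun p => h p u v) U :=
  (hh.smooth.clm_apply contDiffOn_const).clm_apply contDiffOn_const

theorem IsRiemannianMetricOn.areaDensity_pos (hh : IsRiemannianMetricOn h U) {p : ℂ}
    (hp : p ∈ U) : 0 < areaDensity h p :=
  Real.sqrt_pos.2 (hh.det_pos hp)

theorem IsRiemannianMetricOn.contDiffOn_areaDensity (hh : IsRiemannianMetricOn h U) :
    ContDiffOn ℝ ∞ (areaDensity h) U :=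
  (((hh.contDiffOn_apply 1 1).mul (hh.contDiffOn_apply _ _)).sub
    ((hh.contDiffOn_apply _ _).pow 2)).sqrt fun _ hp => (hh.det_pos hp).ne'

theorem IsRiemannianMetricOn.contDiffOn_hamiltonianField (hU : IsOpen U)
    (hh : IsRiemannianMetricOn h U) {H : ℂ → ℝ} (hH : ContDiffOn ℝ ∞ H U) :
    ContDiffOn ℝ ∞ (hamiltonianField h H) U := by
  have hdH : ContDiffOn ℝ ∞ (fderiv ℝ H) U := hH.fderiv_of_isOpen hU (by simp)
  have hquot : ∀ v : ℂ, ContDiffOn ℝ ∞ (fun p => fderiv ℝ H p v / areaDensity h p) U := fun v =>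
    (hdH.clm_apply contDiffOn_const).div hh.contDiffOn_areaDensity
      fun p hp => (hh.areaDensity_pos hp).ne'
  have : hamiltonianField h H = fun p => (fderiv ℝ H p Complex.I / areaDensity h p) • (1 : ℂ) +
      (-(fderiv ℝ H p 1 / areaDensity h p)) • Complex.I := by
    ext p
    apply Complex.ext <;> simp [hamiltonianField]
  rw [this]
  exact ((hquot _).smul contDiffOn_const).add ((hquot _).neg.smul contDiffOn_const)

theorem continuousOn_lieDerivMetric (hU : IsOpen U) (hh : IsRiemannianMetricOn h U) {X : ℂ → ℂ}
    (hX : ContDiffOn ℝ ∞ X U) {u v : ℂ → ℂ} (hu : ContinuousOn u U) (hv : ContinuousOn v U) :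
    ContinuousOn (fun p => lieDerivMetric h X p (u p) (v p)) U := by
  have hdh := hh.smooth.continuousOn_fderiv_of_isOpen hU (by simp)
  have hdX := hX.continuousOn_fderiv_of_isOpen hU (by simp)
  exact ((((hdh.clm_apply hX.continuousOn).clm_apply hu).clm_apply hv).add
    ((hh.smooth.continuousOn.clm_apply (hdX.clm_apply hu)).clm_apply hv)).add
    ((hh.smooth.continuousOn.clm_apply hu).clm_apply (hdX.clm_apply hv))

theorem IsRiemannianMetricOn.continuousOn_frameFst (hh : IsRiemannianMetricOn h U) :
    ContinuousOn (frameFst h) U :=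
  ((hh.contDiffOn_apply 1 1).continuousOn.sqrt.inv₀ fun p hp =>
    (Real.sqrt_pos.2 (hh.pos p hp 1 one_ne_zero)).ne').smul continuousOn_const

theorem IsRiemannianMetricOn.continuousOn_frameSnd (hh : IsRiemannianMetricOn h U) :
    ContinuousOn (frameSnd h) U := by
  refine ContinuousOn.smul (((hh.contDiffOn_apply 1 1).continuousOn.sqrt.mul
    hh.contDiffOn_areaDensity.continuousOn).inv₀ fun p hp => ?_) ?_
  · exact (mul_pos (Real.sqrt_pos.2 (hh.pos p hp 1 one_ne_zero)) (hh.areaDensity_pos hp)).ne'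
  · exact ((hh.contDiffOn_apply 1 1).continuousOn.smul continuousOn_const).sub
      ((hh.contDiffOn_apply _ _).continuousOn.smul continuousOn_const)

theorem ContinuousOn.complex_mk {f g : ℂ → ℝ} (hf : ContinuousOn f U) (hg : ContinuousOn g U) :
    ContinuousOn (fun p => (⟨f p, g p⟩ : ℂ)) U := by
  simp_rw [Complex.mk_eq_add_mul_I]
  exact (Complex.continuous_ofReal.comp_continuousOn hf).add
    ((Complex.continuous_ofReal.comp_continuousOn hg).mul continuousOn_const)

theorem continuousOn_conformalDefect (hU : IsOpen U) (hh : IsRiemannianMetricOn h U) {X : ℂ → ℂ}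
    (hX : ContDiffOn ℝ ∞ X U) : ContinuousOn (conformalDefect h X) U := by
  have h1 := hh.continuousOn_frameFst
  have h2 := hh.continuousOn_frameSnd
  exact (continuousOn_lieDerivMetric hU hh hX h1 h2).complex_mk
    (((continuousOn_lieDerivMetric hU hh hX h2 h2).sub
      (continuousOn_lieDerivMetric hU hh hX h1 h1)).div_const 2)

/-- At a critical point of `H` the linearization of the Hamiltonian field is trace-free, since the
Hessian of `H` is symmetric. -/
theorem trace_fderiv_hamiltonianField (hU : IsOpen U) (hh : IsRiemannianMetricOn h U) {H : ℂ → ℝ}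
    (hH : ContDiffOn ℝ ∞ H U) {p : ℂ} (hp : p ∈ U) (hc : fderiv ℝ H p = 0) :
    (fderiv ℝ (hamiltonianField h H) p 1).re +
      (fderiv ℝ (hamiltonianField h H) p Complex.I).im = 0 := by
  have hX := ((hh.contDiffOn_hamiltonianField hU hH).contDiffAt
    (hU.mem_nhds hp)).differentiableAt (by simp)
  have hHp : ContDiffAt ℝ ∞ H p := hH.contDiffAt (hU.mem_nhds hp)
  have hdH : DifferentiableAt ℝ (fderiv ℝ H) p :=
    (hHp.fderiv_right (m := ∞) (by simp)).differentiableAt (by simp)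
  have hw : DifferentiableAt ℝ (fun q => (areaDensity h q)⁻¹) p :=
    ((hh.contDiffOn_areaDensity.contDiffAt (hU.mem_nhds hp)).differentiableAt (by simp)).inv
      (hh.areaDensity_pos hp).ne'
  have hquot : ∀ v u : ℂ, fderiv ℝ (fun q => fderiv ℝ H q v / areaDensity h q) p u =
      fderiv ℝ (fderiv ℝ H) p u v * (areaDensity h p)⁻¹ := by
    intro v u
    have h1 : HasFDerivAt (fun q => fderiv ℝ H q v) ((fderiv ℝ (fderiv ℝ H) p).flip v) p := by
      have := hdH.hasFDerivAt.clm_apply (hasFDerivAt_const v p)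
      simpa using this
    have h2 : fderiv ℝ (fun q => fderiv ℝ H q v * (areaDensity h q)⁻¹) p = _ :=
      (h1.mul hw.hasFDerivAt).fderiv
    simp only [div_eq_mul_inv]
    rw [h2]
    simp [hc, mul_comm]
  have hre : ∀ u, (fderiv ℝ (hamiltonianField h H) p u).re =
      fderiv ℝ (fun q => fderiv ℝ H q Complex.I / areaDensity h q) p u := fun u => by
    have := (Complex.reCLM.hasFDerivAt.comp p hX.hasFDerivAt).fderiv
    exact (congrArg (fun A => A u) this).symm
  have him : ∀ u, (fderiv ℝ (hamiltonianField h H) p u).im =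
      -fderiv ℝ (fun q => fderiv ℝ H q 1 / areaDensity h q) p u := fun u => by
    have := (Complex.imCLM.hasFDerivAt.comp p hX.hasFDerivAt).fderiv
    have h2 : (Complex.imCLM ∘ hamiltonianField h H) =
      fun q => -(fderiv ℝ H q 1 / areaDensity h q) := rfl
    rw [h2, fderiv_fun_neg] at this
    exact (congrArg (fun A => A u) this).symm
  have hsymm := (hHp.isSymmSndFDerivAt (by
    rw [minSmoothness_of_isRCLikeNormedField]; exact ENat.LEInfty.out)).eq 1 Complex.I
  rw [hre, him, hquot, hquot, hsymm]
  ring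

end Smoothness

/-- A trace-free linear map of the plane that kills `T ≠ 0` has its image in the line of `T`. -/
theorem exists_eq_smul_of_trace_eq_zero (M : ℂ →L[ℝ] ℂ) {T : ℂ} (hT : T ≠ 0) (hMT : M T = 0)
    (htr : (M 1).re + (M Complex.I).im = 0) :
    ∃ c : ℝ, ∀ v, M v = (c * (T.re * v.im - T.im * v.re)) • T := by
  have hexp : ∀ v : ℂ, M v = v.re • M 1 + v.im • M Complex.I := by
    intro v
    rw [← map_smul, ← map_smul, ← map_add]
    congr 1
    apply Complex.ext <;> simp
  have hN : 0 < T.re ^ 2 + T.im ^ 2 := by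
    have := Complex.normSq_pos.2 hT
    rw [Complex.normSq_apply] at this
    linarith
  have h1 := congrArg Complex.re ((hexp T).symm.trans hMT)
  have h2 := congrArg Complex.im ((hexp T).symm.trans hMT)
  simp only [Complex.add_re, Complex.add_im, Complex.real_smul, Complex.re_ofReal_mul,
    Complex.im_ofReal_mul, Complex.zero_re, Complex.zero_im] at h1 h2
  obtain ⟨x, y⟩ := T
  set a := M 1
  set b := M Complex.I
  simp only at h1 h2 hN
  obtain ⟨c, hc⟩ : ∃ c : ℝ, c * (x ^ 2 + y ^ 2) ^ 2 =
      x * (x * b.re - y * a.re) + y * (x * b.im - y * a.im) :=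
    ⟨_, div_mul_cancel₀ _ (pow_ne_zero 2 hN.ne')⟩
  refine ⟨c, fun v => ?_⟩
  rw [hexp v]
  refine Complex.ext (mul_left_cancel₀ (pow_ne_zero 2 hN.ne') ?_)
    (mul_left_cancel₀ (pow_ne_zero 2 hN.ne') ?_)
  · simp only [Complex.add_re, Complex.real_smul, Complex.re_ofReal_mul]
    linear_combination (-((x * v.im - y * v.re) * x)) * hc +
      y * (x * v.im - y * v.re) * (x * h1 + y * h2 - (x ^ 2 + y ^ 2) * htr) +
      (x ^ 2 + y ^ 2) * (x * v.re + y * v.im) * h1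
  · simp only [Complex.add_im, Complex.real_smul, Complex.im_ofReal_mul]
    linear_combination (-((x * v.im - y * v.re) * y)) * hc -
      x * (x * v.im - y * v.re) * (x * h1 + y * h2 - (x ^ 2 + y ^ 2) * htr) +
      (x ^ 2 + y ^ 2) * (x * v.re + y * v.im) * h2

/-- The tangent vector `T` at `p` in the frame `(e₁, e₂)`, as a complex number. -/
noncomputable def frameCoord (h : ℂ → ℂ →L[ℝ] ℂ →L[ℝ] ℝ) (p T : ℂ) : ℂ :=
  ⟨h p T (frameFst h p), h p T (frameSnd h p)⟩

section Frame

variable {h : ℂ → ℂ →L[ℝ] ℂ →L[ℝ] ℝ} {U : Set ℂ} (hh : IsRiemannianMetricOn h U) {p : ℂ}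
  (hp : p ∈ U)

include hh hp

theorem frameCoord_eq (T : ℂ) : frameCoord h p T =
    ⟨(T.re * h p 1 1 + T.im * h p 1 Complex.I) / Real.sqrt (h p 1 1),
      T.im * areaDensity h p / Real.sqrt (h p 1 1)⟩ := by
  have hE : 0 < h p 1 1 := hh.pos p hp 1 one_ne_zero
  have hs := hh.symm p hp Complex.I 1
  have hw0 := hh.areaDensity_pos hp
  have hs0 := Real.sqrt_pos.2 hE
  have hw2 : areaDensity h p ^ 2 = h p 1 1 * h p Complex.I Complex.I - h p 1 Complex.I ^ 2 :=
    Real.sq_sqrt (hh.det_pos hp).le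
  have hT : T = T.re • (1 : ℂ) + T.im • Complex.I := by apply Complex.ext <;> simp
  have h1 : ∀ v, h p T v = T.re * h p 1 v + T.im * h p Complex.I v := fun v => by
    calc h p T v = h p (T.re • (1 : ℂ) + T.im • Complex.I) v := by rw [← hT]
      _ = _ := by simp only [map_add, map_smul, add_apply, smul_apply, smul_eq_mul]
  rw [frameCoord, h1, h1]
  apply Complex.ext
  · simp only [frameFst, map_smul, smul_eq_mul, hs]
    field_simp
  · simp only [frameSnd, map_smul, map_sub, smul_eq_mul, hs]
    field_simp
    linear_combination (-T.im) * hw2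

theorem frameCoord_div_mem_slitPlane {T : ℂ} (hT : T ≠ 0) :
    frameCoord h p T / T ∈ Complex.slitPlane := by
  have hE : 0 < h p 1 1 := hh.pos p hp 1 one_ne_zero
  have hw0 := hh.areaDensity_pos hp
  have hs0 := Real.sqrt_pos.2 hE
  by_contra hcon
  obtain ⟨r, hr0, hr⟩ : ∃ r : ℝ, r ≤ 0 ∧ frameCoord h p T = r * T := by
    rw [Complex.mem_slitPlane_iff, not_or, not_lt, not_not] at hcon
    refine ⟨(frameCoord h p T / T).re, hcon.1, ?_⟩
    have := Complex.re_add_im (frameCoord h p T / T)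
    rw [hcon.2, Complex.ofReal_zero, zero_mul, add_zero] at this
    rw [this, div_mul_cancel₀ _ hT]
  rw [frameCoord_eq hh hp] at hr
  have hre := congrArg Complex.re hr
  have him := congrArg Complex.im hr
  simp only [Complex.re_ofReal_mul, Complex.im_ofReal_mul] at hre him
  have hy : T.im = 0 := by
    have h1 : T.im * (areaDensity h p / Real.sqrt (h p 1 1) - r) = 0 := by
      linear_combination him
    have h2 := div_pos hw0 hs0
    exact (mul_eq_zero.1 h1).resolve_right (by linarith)
  have hx : T.re = 0 := by
    rw [hy] at hre
    have h1 : T.re * (h p 1 1 / Real.sqrt (h p 1 1) - r) = 0 := by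
      linear_combination hre
    have h2 := div_pos hE hs0
    exact (mul_eq_zero.1 h1).resolve_right (by linarith)
  exact hT (Complex.ext hx hy)

/-- At a zero of a field whose linearization is `v ↦ c (T × v) T`, the conformal defect is a real
multiple of the square of the frame coordinate of `T`. -/
theorem conformalDefect_eq_mul_sq {X : ℂ → ℂ} (hX : X p = 0) {T : ℂ} {c : ℝ}
    (hc : ∀ v, fderiv ℝ X p v = (c * (T.re * v.im - T.im * v.re)) • T) :
    conformalDefect h X p = ((c / areaDensity h p : ℝ) : ℂ) * frameCoord h p T ^ 2 := by
  have hE : 0 < h p 1 1 := hh.pos p hp 1 one_ne_zero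
  have hw0 := hh.areaDensity_pos hp
  have hs0 := Real.sqrt_pos.2 hE
  have hs2 : Real.sqrt (h p 1 1) ^ 2 = h p 1 1 := Real.sq_sqrt hE.le
  obtain ⟨ζ, hζ⟩ : ∃ ζ, ζ = frameCoord h p T := ⟨_, rfl⟩
  have hζ1 : h p T (frameFst h p) = ζ.re := by rw [hζ]; rfl
  have hζ2 : h p T (frameSnd h p) = ζ.im := by rw [hζ]; rfl
  have hω1 : T.re * (frameFst h p).im - T.im * (frameFst h p).re = -ζ.im / areaDensity h p := by
    rw [hζ, frameCoord_eq hh hp]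
    simp only [frameFst, Complex.real_smul, Complex.re_ofReal_mul, Complex.im_ofReal_mul,
      Complex.one_re, Complex.one_im]
    field_simp
    ring
  have hω2 : T.re * (frameSnd h p).im - T.im * (frameSnd h p).re = ζ.re / areaDensity h p := by
    rw [hζ, frameCoord_eq hh hp]
    simp only [frameSnd, Complex.real_smul, Complex.re_ofReal_mul, Complex.im_ofReal_mul,
      Complex.one_re, Complex.one_im, Complex.sub_re, Complex.sub_im, Complex.I_re, Complex.I_im]
    field_simp
    ring
  have hL : ∀ u v, lieDerivMetric h X p u v = c * (T.re * u.im - T.im * u.re) * h p T v +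
      c * (T.re * v.im - T.im * v.re) * h p T u := fun u v => by
    rw [lieDerivMetric, hX, hc, hc, hh.symm p hp u]
    simp only [map_zero, map_smul, zero_apply, smul_apply, smul_eq_mul, zero_add]
  rw [← hζ]
  apply Complex.ext
  · rw [Complex.re_ofReal_mul]
    simp only [conformalDefect, hL, hω1, hω2, hζ1, hζ2, pow_two, Complex.mul_re]
    field_simp
    ring
  · rw [Complex.im_ofReal_mul]
    simp only [conformalDefect, hL, hω1, hω2, hζ1, hζ2, pow_two, Complex.mul_im]
    field_simp
    ring

end Frame

/-- Along a curve of critical points of `H`, the conformal defect is a real multiple of the square of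
the frame coordinate of the tangent. -/
theorem exists_conformalDefect_eq {h : ℂ → ℂ →L[ℝ] ℂ →L[ℝ] ℝ} {U : Set ℂ} (hU : IsOpen U)
    (hh : IsRiemannianMetricOn h U) {H : ℂ → ℝ} (hH : ContDiffOn ℝ ∞ H U) {γ : ℝ → ℂ}
    (hγ : Differentiable ℝ γ) (hd : ∀ t, deriv γ t ≠ 0) (hγU : ∀ t, γ t ∈ U)
    (hcrit : ∀ t, fderiv ℝ H (γ t) = 0) (t : ℝ) :
    ∃ μ : ℝ, conformalDefect h (hamiltonianField h H) (γ t) =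
      μ * frameCoord h (γ t) (deriv γ t) ^ 2 := by
  have hX0 : ∀ t, hamiltonianField h H (γ t) = 0 := fun t => by
    apply Complex.ext <;> simp [hamiltonianField, hcrit]
  have hX := ((hh.contDiffOn_hamiltonianField hU hH).contDiffAt
    (hU.mem_nhds (hγU t))).differentiableAt (by simp)
  have hT : fderiv ℝ (hamiltonianField h H) (γ t) (deriv γ t) = 0 := by
    have h1 := hX.hasFDerivAt.comp_hasDerivAt t (hγ t).hasDerivAt
    have h2 : hamiltonianField h H ∘ γ = fun _ => 0 := funext hX0
    rw [h2] at h1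
    exact h1.unique (hasDerivAt_const t 0)
  obtain ⟨c, hc⟩ := exists_eq_smul_of_trace_eq_zero _ (hd t) hT
    (trace_fderiv_hamiltonianField hU hh hH (hγU t) (hcrit t))
  exact ⟨_, conformalDefect_eq_mul_sq hh (hγU t) (hX0 t) hc⟩

/-- A nonvanishing real multiple of the square of a loop has twice its winding number, because the
real factor has constant sign. -/
theorem HasLogWinding.real_mul_sq {f ζ : ℝ → ℂ} {τ : ℤ} (hζ : HasLogWinding ζ τ)
    (hf : Continuous f) (h0 : ∀ t, f t ≠ 0) (hμ : ∀ t, ∃ μ : ℝ, f t = μ * ζ t ^ 2)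
    (hf1 : f 1 = f 0) (hζ1 : ζ 1 = ζ 0) : HasLogWinding f (2 * τ) := by
  choose μ hμ using hμ
  have hζ0 := hζ.ne_zero
  have hμ' : ∀ t, (f t / ζ t ^ 2) = μ t := fun t => by
    rw [hμ t, mul_div_cancel_right₀ _ (pow_ne_zero 2 (hζ0 t))]
  have hμ0 : ∀ t, μ t ≠ 0 := fun t h => h0 t (by rw [hμ t, h]; simp)
  have hμc : Continuous μ := by
    have : μ = fun t => (f t / ζ t ^ 2).re := funext fun t => by rw [hμ', Complex.ofReal_re]
    rw [this]
    exact Complex.continuous_re.comp (hf.div (hζ.continuous.pow 2) fun t => pow_ne_zero 2 (hζ0 t))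
  have hpos : ∀ t, 0 < μ t / μ 0 := by
    intro t
    by_contra hcon
    obtain ⟨s, hs⟩ := mem_range_of_exists_le_of_exists_ge (f := fun t => μ t / μ 0) (c := 0)
      (hμc.div_const _) ⟨t, not_lt.1 hcon⟩ ⟨0, by simp [div_self (hμ0 0)]⟩
    exact div_ne_zero (hμ0 s) (hμ0 0) hs
  have hconst : HasLogWinding (fun t => f t / ζ t ^ 2) 0 := by
    refine (HasLogWinding.const (c := μ 0) (by exact_mod_cast hμ0 0)).of_div_slitPlane
      (hf.div (hζ.continuous.pow 2) fun t => pow_ne_zero 2 (hζ0 t)) (fun t => ?_)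
      (by rw [hf1, hζ1]) rfl
    rw [hμ', ← Complex.ofReal_div]
    exact Complex.ofReal_mem_slitPlane.2 (hpos t)
  have := hconst.mul (hζ.zpow 2)
  rw [zero_add] at this
  convert this using 2 with t
  rw [zpow_ofNat, div_mul_cancel₀ _ (pow_ne_zero 2 (hζ0 t))]

/-! ### The sum of the multiplicities -/

theorem mainTheorem2 (D U : Set ℂ) (hD : IsSmoothJordanDomain D) (hU : IsOpen U) (hDU : D ⊆ U)
    (h : ℂ → ℂ →L[ℝ] ℂ →L[ℝ] ℝ) (hh : IsRiemannianMetricOn h U)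
    (H : ℂ → ℝ) (hH : ContDiffOn ℝ ∞ H U)
    (hdH : ∀ p ∈ frontier D, fderiv ℝ H p = 0)
    (hconf : ∀ p ∈ frontier D, ¬ IsConformalPoint h (hamiltonianField h H) p) :
    {p ∈ interior D | IsConformalPoint h (hamiltonianField h H) p}.Infinite ∨
      ∃ (Z : Finset ℂ) (m : ℂ → ℤ),
        (Z : Set ℂ) = {p ∈ interior D | IsConformalPoint h (hamiltonianField h H) p} ∧
        (∀ p ∈ Z, HasConformalMultiplicity h (hamiltonianField h H) p (m p)) ∧
        ∑ p ∈ Z, m p = 2 := by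
  obtain ⟨γ, hγ, hp, hi, hd, hfr⟩ := hD.boundary
  obtain ⟨p₀, hp₀⟩ := hD.interior_nonempty
  set X := hamiltonianField h H
  set V := conformalDefect h X
  have hVU : ContinuousOn V U :=
    continuousOn_conformalDefect hU hh (hh.contDiffOn_hamiltonianField hU hH)
  have hfrD : ∀ t, γ t ∈ frontier D := fun t => hfr ▸ mem_range_self t
  have hγD : ∀ t, γ t ∈ D := fun t => hD.isCompact.isClosed.frontier_subset (hfrD t)
  have hγU : ∀ t, γ t ∈ U := fun t => hDU (hγD t)
  have hVγ : Continuous fun t => V (γ t) := hVU.comp_continuous hγ.continuous hγU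
  have hVp : Function.Periodic (fun t => V (γ t)) 1 := fun t => by simp only [hp t]
  have hV0 : ∀ p ∈ D, p ∉ {p ∈ interior D | IsConformalPoint h X p} → V p ≠ 0 := by
    intro p hpD hpS h0
    have hc := (conformalDefect_eq_zero_iff hU hh X (hDU hpD)).1 h0
    by_cases hpi : p ∈ interior D
    · exact hpS ⟨hpi, hc⟩
    · exact hconf p ⟨subset_closure hpD, hpi⟩ hc
  -- along the boundary `V` turns twice as often as the tangent
  obtain ⟨τ, hτ, hτ₀⟩ := exists_winding_eq_turning hD.isCompact hγ hp hi hd hfr hp₀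
  have h01 : γ 1 = γ 0 := by simpa using hp 0
  have hd01 : deriv γ 1 = deriv γ 0 := by simpa using hp.deriv_periodic 0
  have hdc : Continuous (deriv γ) := hγ.continuous_deriv (by simp)
  have hζc : Continuous fun t => frameCoord h (γ t) (deriv γ t) := by
    have hhγ : Continuous fun t => h (γ t) := hh.smooth.continuousOn.comp_continuous hγ.continuous hγU
    simp_rw [frameCoord, Complex.mk_eq_add_mul_I]
    refine (Complex.continuous_ofReal.comp ((hhγ.clm_apply hdc).clm_apply
      (hh.continuousOn_frameFst.comp_continuous hγ.continuous hγU))).add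
      ((Complex.continuous_ofReal.comp ((hhγ.clm_apply hdc).clm_apply
      (hh.continuousOn_frameSnd.comp_continuous hγ.continuous hγU))).mul continuous_const)
  have hζ : HasLogWinding (fun t => frameCoord h (γ t) (deriv γ t)) τ :=
    hτ.of_div_slitPlane hζc (fun t => frameCoord_div_mem_slitPlane hh (hγU t) (hd t))
      (by rw [h01, hd01]) hd01
  have hVτ : HasLogWinding (fun t => V (γ t)) (2 * τ) :=
    hζ.real_mul_sq hVγ (fun t => hV0 _ (hγD t) fun hS => (hfrD t).2 hS.1)
      (exists_conformalDefect_eq hU hh hH (hγ.differentiable (by simp)) hd hγU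
        fun t => hdH _ (hfrD t))
      (by simp only [h01]) (by rw [h01, hd01])
  -- on the boundary `V` is `exp l * (z - p₀) ^ 2`, whatever the sign of `τ`
  have hquot := hVτ.div (hτ₀.zpow 2)
  rw [sub_self] at hquot
  obtain ⟨l, hl, hlV⟩ := exists_exp_extension hγ.continuous hp hi hquot fun t => by
    simp only [hp t]
  refine or_iff_not_imp_left.2 fun hfin => ?_
  rw [not_infinite] at hfin
  -- conformal points are isolated, since there are finitely many in the interior
  have hindex : ∀ p ∈ {p ∈ interior D | IsConformalPoint h X p}, ∃ n : ℤ,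
      ∀ᶠ r in 𝓝[>] (0 : ℝ), HasLogWinding (fun t => V (circleMap p r (2 * Real.pi * t))) n := by
    intro p hpS
    have hopen : IsOpen (interior D \ ({p ∈ interior D | IsConformalPoint h X p} \ {p})) :=
      isOpen_interior.sdiff (hfin.subset sdiff_subset).isClosed
    obtain ⟨R, hR, hball⟩ := Metric.isOpen_iff.1 hopen p ⟨hpS.1, fun h => h.2 rfl⟩
    obtain ⟨n, hn⟩ := exists_winding_circleMap (V := V) (p := p) (R := R)
      (hVU.mono fun z hz => hDU (interior_subset (hball hz).1))
      fun z hz hzp => hV0 z (interior_subset (hball hz).1) fun hS => (hball hz).2 ⟨hS, hzp⟩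
    refine ⟨n, ?_⟩
    filter_upwards [self_mem_nhdsWithin, mem_nhdsWithin_of_mem_nhds (Iio_mem_nhds hR)]
      with r h1 h2 using hn r h1 h2
  choose! m hm using hindex
  refine ⟨hfin.toFinset, m, hfin.coe_toFinset, fun p hpZ => ?_, ?_⟩
  · have hpS := hfin.mem_toFinset.1 hpZ
    exact ⟨hpS.2, (hm p hpS).mono fun r hr =>
      HasLogWinding.hasWindingNumber (f := fun θ => V (circleMap p r θ)) hr⟩
  · refine sum_index_eq_of_frontier hD.isCompact.isClosed hD.isCompact.isBounded hp₀
      (hVU.mono hDU) hl (fun z hz => ?_) _ m (fun q hq => (hfin.mem_toFinset.1 hq).1)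
      (fun z hz hzZ => hV0 z hz fun hS => hzZ (hfin.mem_toFinset.2 hS))
      (fun q hq => hm q (hfin.mem_toFinset.1 hq))
    rw [hfr] at hz
    obtain ⟨t, rfl⟩ := hz
    rw [hlV, div_mul_cancel₀ _ (zpow_ne_zero _ (hτ₀.ne_zero t))]
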